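/- Let $\Gamma$ be a finite set with $N>1$ elements, and let $\Omega$ be a finite set with $J\ge 1$ elements. Let ${\cal D}_N$ be the Dyck inverse monoid (polycyclic monoid): the monoid with zero that is presented by the generators $\gamma(-),\gamma(+)$, $\gamma\in\Gamma$, and the relations $\gamma(-)\gamma(+)=1$, and $\gamma(-)\gamma'(+)=0$ for $\gamma\ne\gamma'$. Let $X(G_\bigcirc(N,J,1))$ be the subshift with alphabet $\Omega\cup\{\gamma(-),\gamma(+):\gamma\in\Gamma\}$ whose admissible words are the words $\sigma_1\cdots\sigma_n$ with $\varphi(\sigma_1)\cdots\varphi(\sigma_n)\neq 0$ in ${\cal D}_N$, where $\varphi(\omega)=1$ for $\omega\in\Omega$, and $\varphi(\gamma(\pm))=\gamma(\pm)$ for $\gamma\in\Gamma$. (It is given by the graph with one vertex that has the $J$ loops $\omega\in\Omega$ and the loops $\gamma(-)$, $\gamma(+)$, $\gamma\in\Gamma$.) Let $1\le K,L\le J$. Let $\Xi_\Omega$ assign to every $\omega\in\Omega$ a subset $\Xi_\Omega(\omega)\subset\Omega$ with ${\rm card}(\Xi_\Omega(\omega))=K$, and let $\Xi_\Gamma$ assign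 to every $\gamma\in\Gamma$ a subset $\Xi_\Gamma(\gamma)\subset\Omega$ with ${\rm card}(\Xi_\Gamma(\gamma))=L$. Let $X_{N,\Xi_\Omega,\Xi_\Gamma}$ be the subshift that is obtained by excluding from $X(G_\bigcirc(N,J,1))$ the words $$\gamma(+)\gamma'(-),\quad \gamma(+)\gamma'(+),\qquad \gamma,\gamma'\in\Gamma,$$ $$\omega\omega'\gamma(+),\quad \gamma(-)\omega\gamma(+),\qquad \omega,\omega'\in\Omega,\ \gamma\in\Gamma,$$ $$\omega\gamma(+)\omega',\qquad \gamma\in\Gamma,\ \omega,\omega'\in\Omega,\ \omega'\notin\Xi_\Omega(\omega),$$ $$\gamma(-)\gamma(+)\omega,\qquad \gamma\in\Gamma,\ \omega\in\Omega,\ \omega\notin\Xi_\Gamma(\gamma).$$ Assume that the transition matrix $A$ with index set $\Omega$, given by $A(\omega,\omega')=1$ if $\omega'\in\Xi_\Omega(\omega)$ and $A(\omega,\omega')=0$ otherwise, is irreducible, and let $\pi$ be its period. Then there is a (unique) polynomial $q$ with integer coefficients such that $$\det(1-Az)=q(z)\,(1-K^\pi z^\pi),$$ and with $$g(z)=\tfrac12\Big(1-Jz+N(L-K)z^3-\sqrt{(1-Jz+N(L-K)z^3)^2-4NLz^3(1-Jz)}\Big)$$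 one has $$\zeta_{X_{N,\Xi_\Omega,\Xi_\Gamma}}(z)=\frac{1-Jz-g(z)}{\big(1-(J+N)z-g(z)\big)\big((1-NKz^2)(1-Jz)-g(z)\big)\,q(Nz^2)\,\sum_{0\le r<\pi}N^rK^rz^{2r}}.$$ Here $\zeta_X(z)=\exp\big(\sum_{n\ge1}\frac1n{\rm card}(P_n(X))z^n\big)$, where $P_n(X)$ is the set of points of $X$ that are fixed by the $n$-th power of the shift. The identity is one of formal power series in $z$ with rational coefficients, and the square root is the one with constant term $1$. -/

import Mathlib

namespace DyckLoop

/-! ### The Dyck inverse monoid -/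

/-- The generators `γ(-)` (`neg γ`) and `γ(+)` (`pos γ`), `γ ∈ Γ`. -/
inductive Gen (Γ : Type*) where
  | neg (γ : Γ)
  | pos (γ : Γ)

/-- The word of length one formed by a generator, in the free monoid with a zero adjoined. -/
def Gen.word {Γ : Type*} (a : Gen Γ) : WithZero (FreeMonoid (Gen Γ)) :=
  ((FreeMonoid.of a : FreeMonoid (Gen Γ)) : WithZero (FreeMonoid (Gen Γ)))

/-- The defining relations: `γ(-) γ(+) = 1`, and `γ(-) γ'(+) = 0` for `γ ≠ γ'`. -/
inductive DyckRel (Γ : Type*) :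
    WithZero (FreeMonoid (Gen Γ)) → WithZero (FreeMonoid (Gen Γ)) → Prop
  | same (γ : Γ) : DyckRel Γ ((Gen.neg γ).word * (Gen.pos γ).word) 1
  | diff (γ γ' : Γ) (h : γ ≠ γ') : DyckRel Γ ((Gen.neg γ).word * (Gen.pos γ').word) 0

/-- The Dyck inverse monoid (polycyclic monoid) on `Γ`: the monoid with zero presented by the
generators `γ(-)`, `γ(+)` and the relations `DyckRel`. -/
abbrev DyckMonoid (Γ : Type*) : Type _ := (conGen (DyckRel Γ)).Quotient

/-- The zero of the Dyck inverse monoid is the class of the adjoined zero. -/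
instance (Γ : Type*) : Zero (DyckMonoid Γ) :=
  ⟨((0 : WithZero (FreeMonoid (Gen Γ))) : (conGen (DyckRel Γ)).Quotient)⟩

/-- The element of the Dyck inverse monoid given by a generator. -/
def Gen.toDyck {Γ : Type*} (a : Gen Γ) : DyckMonoid Γ :=
  ((a.word : WithZero (FreeMonoid (Gen Γ))) : (conGen (DyckRel Γ)).Quotient)

/-! ### Subshifts, given by their sets of points -/

/-- The word `x_i x_{i+1} ⋯ x_{i+n-1}` of the point `x`. -/
def subword {S : Type*} (x : ℤ → S) (i : ℤ) (n : ℕ) : List S :=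
  List.ofFn fun k : Fin n => x (i + (k : ℕ))

/-- The word `w` appears in the point `x`. -/
def Appears {S : Type*} (w : List S) (x : ℤ → S) : Prop :=
  ∃ i : ℤ, subword x i w.length = w

/-- The points of `Y` in which none of the words of `F` appears. -/
def excludeWords {S : Type*} (Y : Set (ℤ → S)) (F : Set (List S)) : Set (ℤ → S) :=
  {x ∈ Y | ∀ w ∈ F, ¬ Appears w x}

/-- `P_n(Y)`: the points of `Y` that are fixed by the `n`-th power of the shift. -/
def periodicPoints {S : Type*} (Y : Set (ℤ → S)) (n : ℕ) : Set (ℤ → S) :=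
  {x ∈ Y | ∀ i : ℤ, x (i + n) = x i}

/-- The zeta function `exp (∑_{n ≥ 1} card (P_n(Y)) z^n / n)` as a formal power series. (The
coefficient with index `0` of the inner series is `0`, because `a / 0 = 0`.) -/
noncomputable def zeta {S : Type*} (Y : Set (ℤ → S)) : PowerSeries ℚ :=
  (PowerSeries.exp ℚ).subst
    (PowerSeries.mk fun n : ℕ => ((periodicPoints Y n).ncard : ℚ) / (n : ℚ))

/-! ### The subshift of a one-vertex graph with `Ω`-loops and Dyck loops -/

/-- The edges, all of them loops at the single vertex, of the graph that is obtained by attaching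
loops `γ(-)`, `γ(+)`, one for each `γ ∈ Γ`, to the vertex of the bouquet whose loops are the
elements of `Ω`. Every edge is labelled by itself. -/
inductive Symbol (Γ Ω : Type*) where
  | neg (γ : Γ)
  | pos (γ : Γ)
  | loop (ω : Ω)

/-- The map `φ` to the Dyck inverse monoid: `γ(±)` is sent to itself and `ω ∈ Ω` to `1`. -/
def Symbol.toDyck {Γ Ω : Type*} : Symbol Γ Ω → DyckMonoid Γ
  | .neg γ => (Gen.neg γ).toDyck
  | .pos γ => (Gen.pos γ).toDyck
  | .loop _ => 1

/-- A word is admissible if the product of its `φ`-images is not zero. (The graph has only one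
vertex, so that every word in the symbols is a path.) -/
def Admissible {Γ Ω : Type*} (w : List (Symbol Γ Ω)) : Prop :=
  (w.map Symbol.toDyck).prod ≠ 0

/-- The subshift of the graph: its points are the bi-infinite sequences all of whose words are
admissible. -/
def bouquetShift (Γ Ω : Type*) : Set (ℤ → Symbol Γ Ω) :=
  {x | ∀ (i : ℤ) (n : ℕ), Admissible (subword x i n)}

/-- The words to be excluded. -/
inductive ExcludedWord {Γ Ω : Type*} (ΞΩ : Ω → Finset Ω) (ΞΓ : Γ → Finset Ω) :
    List (Symbol Γ Ω) → Prop
  | pos_neg (γ γ' : Γ) : ExcludedWord ΞΩ ΞΓ [.pos γ, .neg γ']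
  | pos_pos (γ γ' : Γ) : ExcludedWord ΞΩ ΞΓ [.pos γ, .pos γ']
  | loop_loop_pos (ω ω' : Ω) (γ : Γ) : ExcludedWord ΞΩ ΞΓ [.loop ω, .loop ω', .pos γ]
  | neg_loop_pos (γ : Γ) (ω : Ω) : ExcludedWord ΞΩ ΞΓ [.neg γ, .loop ω, .pos γ]
  | loop_pos_loop (γ : Γ) (ω ω' : Ω) (h : ω' ∉ ΞΩ ω) :
      ExcludedWord ΞΩ ΞΓ [.loop ω, .pos γ, .loop ω']
  | neg_pos_loop (γ : Γ) (ω : Ω) (h : ω ∉ ΞΓ γ) :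
      ExcludedWord ΞΩ ΞΓ [.neg γ, .pos γ, .loop ω]

/-- The subshift `X_{N, Ξ_Ω, Ξ_Γ}`. -/
def xiShift {Γ Ω : Type*} (ΞΩ : Ω → Finset Ω) (ΞΓ : Γ → Finset Ω) : Set (ℤ → Symbol Γ Ω) :=
  excludeWords (bouquetShift Γ Ω) {w | ExcludedWord ΞΩ ΞΓ w}

/-! ### The transition matrix -/

/-- The 0-1 transition matrix of the map `ΞΩ`. -/
def transitionMatrix {Ω : Type*} [DecidableEq Ω] (ΞΩ : Ω → Finset Ω) : Matrix Ω Ω ℤ :=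
  Matrix.of fun ω ω' => if ω' ∈ ΞΩ ω then 1 else 0

/-- The period of a nonnegative square matrix: the greatest common divisor of the lengths `n ≥ 1`
of the closed paths in its graph. -/
noncomputable def matrixPeriod {Ω : Type*} [Fintype Ω] [DecidableEq Ω] (A : Matrix Ω Ω ℤ) : ℕ :=
  Nat.setGcd {n : ℕ | 1 ≤ n ∧ ∃ ω : Ω, 0 < (A ^ n) ω ω}

/-- `det (1 - A z)` as a polynomial in `z`. -/
noncomputable def detOneSub {Ω : Type*} [Fintype Ω] [DecidableEq Ω] (A : Matrix Ω Ω ℤ) :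
    Polynomial ℤ :=
  (1 - (Polynomial.X : Polynomial ℤ) • A.map Polynomial.C).det

end DyckLoop

/-! A word with nonzero product has a normal form: its unmatched γ(+), followed by its unmatched
γ(-) (`run`, `admissible_iff`). Rotating a period of a periodic point suitably leaves unmatched
letters of at most one sign (`run_rotate`). In a point of the subshift, a γ(+) stands directly after
a γ(-) or directly after some γ'(+)ω, and it is followed by a letter of Ω; so the γ(+) occur in
descents γ(+)ωγ'(+)ω'⋯. A periodic point therefore either repeats a clean word, one cut outside the
descents, or consists of one endless descent (`periodicPoints_eq`).

The clean words without unmatched γ(+), those without unmatched γ(-), and those with neither form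
very pure monoids. For a very pure monoid with length series W, the series X·W'/W counts the points
that repeat its words (`circSeries_mul`). The endless descents of even period 2m number
2·N^m·tr(A^m), which is the contribution of 1/det(1 - NAz²) (`altDet_logDeriv`). Inclusion-exclusion
gives ζ = a₁a₂/(a₀d), where a₀, a₁, a₂ are the series of `balanced`, `ascending`, `descending` and d
is this determinant (`zeta_mul`).

The series follow from an unambiguous grammar that strips the end of a clean word. Let g count the
arches γ(-)uγ(+)ω with u balanced. Either u is empty, with L choices of ω, or u ends with a descent,
with K choices; hence g = NLz³ + NKz³·a₀g. With a₀(1 - Jz - g) = 1 this is the quadratic equation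
whose root is the stated g. Similarly a₁(1 - (J+N)z - g) = 1, while in a₂ the unmatched descents
bring in the factor 1 - NKz².

Finally, all row sums of A are K. Modulo 1 - K^πX^π the element KX is a π-th root of unity, and its
powers along the cyclic classes of A form a kernel vector of 1 - AX with unit entries, so the
modulus divides the determinant (`one_sub_dvd_detOneSub`). After substituting Nz², the numerator 1 -
NKz² of a₂ cancels against this factor and leaves the geometric sum. -/

namespace DyckLoop

/-! ### Cyclic classes of an irreducible matrix and a factor of its determinant. -/

section Period

variable {Ω : Type*} [Fintype Ω] [DecidableEq Ω]

lemma pow_add_apply_pos {A : Matrix Ω Ω ℤ} (hA : ∀ i j, 0 ≤ A i j) {a b : ℕ} {i j k : Ω}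
    (h₁ : 0 < (A ^ a) i j) (h₂ : 0 < (A ^ b) j k) : 0 < (A ^ (a + b)) i k := by
  rw [pow_add, Matrix.mul_apply]
  refine (mul_pos h₁ h₂).trans_le
    (Finset.single_le_sum (f := fun l => (A ^ a) i l * (A ^ b) l k) (fun l _ => ?_)
      (Finset.mem_univ j))
  exact mul_nonneg (Matrix.pow_apply_nonneg hA _ _ _) (Matrix.pow_apply_nonneg hA _ _ _)

lemma matrixPeriod_dvd {A : Matrix Ω Ω ℤ} {n : ℕ} (hn : 1 ≤ n) {ω : Ω} (h : 0 < (A ^ n) ω ω) :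
    matrixPeriod A ∣ n :=
  Nat.setGcd_dvd_of_mem ⟨hn, ω, h⟩

lemma matrixPeriod_pos [Nonempty Ω] {A : Matrix Ω Ω ℤ} (hA : A.IsIrreducible) :
    0 < matrixPeriod A := by
  obtain ⟨ω⟩ := ‹Nonempty Ω›
  obtain ⟨k, hk, h⟩ := (Matrix.isIrreducible_iff_exists_pow_pos hA.nonneg).1 hA ω ω
  exact Nat.pos_of_dvd_of_pos (matrixPeriod_dvd hk h) hk

/-- The cyclically moving classes of an irreducible matrix. -/
lemma exists_phase [Nonempty Ω] {A : Matrix Ω Ω ℤ} (hA : A.IsIrreducible) :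
    ∃ θ : Ω → ZMod (matrixPeriod A), ∀ i j, 0 < A i j → θ j = θ i + 1 := by
  obtain ⟨o⟩ := ‹Nonempty Ω›
  have hirr := (Matrix.isIrreducible_iff_exists_pow_pos hA.nonneg).1 hA
  choose d hd hpos using hirr o
  -- `d i` is the length of some path from a base vertex to `i`. Closing up two paths to `j` by one
  -- common return path shows that their lengths agree modulo the period.
  refine ⟨fun i => (d i : ZMod _), fun i j hij => ?_⟩
  obtain ⟨r, hr, hret⟩ := hirr j o
  have h₁ : 0 < (A ^ (d i + 1)) o j := pow_add_apply_pos hA.nonneg (hpos i) (by simpa using hij)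
  have h₂ := matrixPeriod_dvd (by omega) (pow_add_apply_pos hA.nonneg h₁ hret)
  have h₃ := matrixPeriod_dvd (by omega) (pow_add_apply_pos hA.nonneg (hpos j) hret)
  rw [← ZMod.natCast_eq_zero_iff] at h₂ h₃
  push_cast at h₂ h₃
  linear_combination h₃ - h₂

/-- Multiplying by the adjugate gives `det M • v = 0`. Over a general commutative ring this needs a
unit entry of `v`; a nonzero vector would not do. -/
lemma det_eq_zero_of_mulVec_eq_zero {R : Type*} [CommRing R] {M : Matrix Ω Ω R} {v : Ω → R}
    (h : M.mulVec v = 0) {i : Ω} (hi : IsUnit (v i)) : M.det = 0 := by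
  have h₁ : (M.adjugate * M).mulVec v = 0 := by rw [← Matrix.mulVec_mulVec, h, Matrix.mulVec_zero]
  rw [Matrix.adjugate_mul, Matrix.smul_mulVec, Matrix.one_mulVec] at h₁
  exact hi.mul_left_eq_zero.1 (by simpa using congrFun h₁ i)

/-- If all row sums of an irreducible `0`-`1` matrix of period `p` are equal to `K`, then
`1 - K ^ p z ^ p` divides `det (1 - A z)`. -/
lemma one_sub_dvd_detOneSub [Nonempty Ω] {ΞΩ : Ω → Finset Ω} {K : ℕ}
    (hΞΩ : ∀ ω, (ΞΩ ω).card = K) (hA : (transitionMatrix ΞΩ).IsIrreducible) :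
    (1 - (K : Polynomial ℤ) ^ matrixPeriod (transitionMatrix ΞΩ) *
      Polynomial.X ^ matrixPeriod (transitionMatrix ΞΩ)) ∣
      detOneSub (transitionMatrix ΞΩ) := by
  obtain ⟨θ, hθ⟩ := exists_phase hA
  have hp := matrixPeriod_pos hA
  generalize matrixPeriod (transitionMatrix ΞΩ) = p at θ hθ hp ⊢
  have : NeZero p := ⟨hp.ne'⟩
  set I := Ideal.span {1 - (K : Polynomial ℤ) ^ p * Polynomial.X ^ p}
  rw [← Ideal.mem_span_singleton, ← Ideal.Quotient.eq_zero_iff_mem]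
  change Ideal.Quotient.mk I _ = 0
  set f := Ideal.Quotient.mk I
  -- In the quotient `u = KX` satisfies `u ^ p = 1`, so its powers can be indexed by `ZMod p`.
  set u := f ((K : Polynomial ℤ) * Polynomial.X) with hu
  have hup : u ^ p = 1 := by
    have : f (1 - (K : Polynomial ℤ) ^ p * Polynomial.X ^ p) = 0 :=
      Ideal.Quotient.eq_zero_iff_mem.2 (Ideal.subset_span rfl)
    rw [hu, ← map_pow, mul_pow]
    rw [map_sub, map_one] at this
    linear_combination -this
  have hval (a : ZMod p) : u ^ (a + 1).val = u * u ^ a.val := by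
    rw [← pow_succ', ZMod.val_add]
    rw [pow_eq_pow_mod _ hup, pow_eq_pow_mod (a.val + 1) hup, ZMod.val_one_eq_one_mod]
    simp
  have hunit : IsUnit u := IsUnit.of_mul_eq_one (u ^ (p - 1)) (by rw [← pow_succ', Nat.sub_add_cancel hp, hup])
  obtain ⟨o⟩ := ‹Nonempty Ω›
  rw [detOneSub, RingHom.map_det]
  -- All `K` successors of `ω` lie in the class `θ ω + 1`, so the row of `ω` sends `v` to `v ω -
  -- K·X·u⁻¹·v ω = 0`.
  refine det_eq_zero_of_mulVec_eq_zero (v := fun ω => u ^ (-θ ω).val) ?_ (hunit.pow _ : IsUnit (u ^ (-θ o).val))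
  ext ω
  have key : ∀ ω' ∈ ΞΩ ω, u ^ (-θ ω).val = u * u ^ (-θ ω').val := by
    intro ω' h
    rw [hθ ω ω' (by simp [transitionMatrix, h]), ← hval]
    congr 2; ring
  have hsum : ∑ ω' ∈ ΞΩ ω, f Polynomial.X * u ^ (-θ ω').val = u ^ (-θ ω).val := by
    have : ∀ ω' ∈ ΞΩ ω, f Polynomial.X * u ^ (-θ ω').val
        = f Polynomial.X * u ^ (p - 1) * u ^ (-θ ω).val := by
      intro ω' h
      rw [key ω' h]
      have : u ^ (p - 1) * u = 1 := by rw [← pow_succ, Nat.sub_add_cancel hp, hup]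
      linear_combination (- f Polynomial.X * u ^ (-θ ω').val) * this
    rw [Finset.sum_congr rfl this, Finset.sum_const, hΞΩ, nsmul_eq_mul]
    have : (K : Polynomial ℤ ⧸ I) * f Polynomial.X * u ^ (p - 1) = 1 := by
      rw [← hup]; nth_rewrite 2 [← Nat.sub_add_cancel hp]
      rw [pow_succ', hu]; simp [map_mul]
    linear_combination u ^ (-θ ω).val * this
  simp only [Matrix.mulVec, dotProduct, Pi.zero_apply]
  simp only [RingHom.mapMatrix_apply, Matrix.map_apply, Matrix.sub_apply, Matrix.one_apply,
    Matrix.smul_apply, smul_eq_mul, map_sub, map_mul, sub_mul, Finset.sum_sub_distrib]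
  rw [sub_eq_zero]
  trans u ^ (-θ ω).val
  · rw [Finset.sum_eq_single ω] <;> simp +contextual [eq_comm]
  · rw [← hsum]
    simp only [transitionMatrix, Matrix.of_apply]
    simp [ite_mul, apply_ite]

end Period

/-! ### Zeta functions through logarithmic derivatives. -/

section LogDerivative

open PowerSeries

/-- Two power series with constant term `1` and the same logarithmic derivative are equal. -/
lemma eq_of_logDeriv_eq {F G : PowerSeries ℚ} (hF : constantCoeff F = 1)
    (hG : constantCoeff G = 1)
    (h : PowerSeries.X * derivative ℚ F * G = PowerSeries.X * derivative ℚ G * F) : F = G := by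
  have hG0 : constantCoeff G ≠ 0 := by simp [hG]
  have h' : derivative ℚ F * G = derivative ℚ G * F := by
    refine mul_left_cancel₀ (X_ne_zero (R := ℚ)) ?_
    linear_combination h
  have hinv : G * G⁻¹ = 1 := PowerSeries.mul_inv_cancel G hG0
  have : F * G⁻¹ = 1 := by
    refine derivative.ext ?_ (by simp [hF, hG])
    rw [Derivation.leibniz, derivative_inv', derivative_one, smul_eq_mul, smul_eq_mul]
    linear_combination (G⁻¹) ^ 2 * h' - derivative ℚ F * G⁻¹ * hinv
  linear_combination G * this - F * hinv

/-- The generating function of the numbers of periodic points. -/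
noncomputable def periodicSeries {S : Type*} (Y : Set (ℤ → S)) : PowerSeries ℚ :=
  PowerSeries.mk fun n => if n = 0 then 0 else ((periodicPoints Y n).ncard : ℚ)

lemma hasSubst_mk {c : ℕ → ℚ} (h : c 0 = 0) : HasSubst (PowerSeries.mk c) :=
  HasSubst.of_constantCoeff_zero' (by simp [h])

/-- A power series with constant term `1` whose logarithmic derivative counts the periodic points
of `Y` is the zeta function of `Y`. -/
lemma zeta_eq {S : Type*} {Y : Set (ℤ → S)} {F : PowerSeries ℚ} (hF : constantCoeff F = 1)
    (h : PowerSeries.X * derivative ℚ F = periodicSeries Y * F) : zeta Y = F := by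
  set G : PowerSeries ℚ := PowerSeries.mk fun n : ℕ => ((periodicPoints Y n).ncard : ℚ) / (n : ℚ)
    with hG
  have hs : HasSubst G := hasSubst_mk (by simp)
  have hXG : PowerSeries.X * derivative ℚ G = periodicSeries Y := by
    ext n
    cases n with
    | zero => simp [periodicSeries]
    | succ n =>
      rw [PowerSeries.coeff_succ_X_mul, coeff_derivative]
      simp only [hG, periodicSeries, coeff_mk]
      simp
      field_simp
  have hz : zeta Y = (PowerSeries.exp ℚ).subst G := rfl
  refine eq_of_logDeriv_eq ?_ hF ?_
  · rw [hz, ← coeff_zero_eq_constantCoeff_apply, coeff_subst' hs, finsum_eq_single _ 0]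
    · simp
    · intro n hn
      have : constantCoeff G = 0 := by simp [hG]
      simp [this, hn]
  · rw [h, hz, derivative_subst hs, derivative_exp]
    linear_combination (PowerSeries.exp ℚ).subst G * F * hXG

end LogDerivative

/-! ### The derivative of a determinant. -/

section Jacobi

variable {R S : Type*} [CommRing R] [CommRing S] [Algebra R S] {n : Type*} [Fintype n]
  [DecidableEq n]

lemma derivation_prod (D : Derivation R S S) {ι : Type*} [DecidableEq ι] (s : Finset ι)
    (f : ι → S) : D (∏ i ∈ s, f i) = ∑ i ∈ s, (∏ j ∈ s.erase i, f j) * D (f i) := by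
  induction s using Finset.induction_on with
  | empty => simp
  | insert a s ha ih =>
    rw [Finset.prod_insert ha, Derivation.leibniz, ih, Finset.sum_insert ha,
      Finset.erase_insert ha, smul_eq_mul, smul_eq_mul, add_comm, Finset.mul_sum]
    congr 1
    refine Finset.sum_congr rfl fun i hi => ?_
    have hia : a ≠ i := fun h => ha (h ▸ hi)
    rw [Finset.erase_insert_of_ne hia, Finset.prod_insert (by simp [ha]), mul_assoc]

/-- Jacobi's formula for the derivative of a determinant. -/
lemma derivation_det (D : Derivation R S S) (M : Matrix n n S) :
    D M.det = (M.adjugate * M.map D).trace := by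
  -- By Cramer's rule a diagonal entry is the determinant with one column differentiated. The sum of
  -- these is the Leibniz rule applied to the permutation expansion.
  have h : ∀ i, (M.adjugate * M.map D) i i = (M.updateCol i fun j => D (M j i)).det := by
    intro i
    rw [← Matrix.cramer_apply, Matrix.cramer_eq_adjugate_mulVec]
    rfl
  simp only [Matrix.trace, Matrix.diag, h, Matrix.det_apply, map_sum]
  rw [Finset.sum_comm]
  refine Finset.sum_congr rfl fun σ _ => ?_
  rw [← Finset.smul_sum, Units.smul_def, Units.smul_def, map_zsmul, derivation_prod]
  congr 1
  refine Finset.sum_congr rfl fun i _ => ?_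
  rw [← Finset.mul_prod_erase _ _ (Finset.mem_univ i), Matrix.updateCol_self, mul_comm]
  congr 1
  refine Finset.prod_congr rfl fun j hj => ?_
  rw [Matrix.updateCol_ne (Finset.ne_of_mem_erase hj)]

end Jacobi

/-! ### The logarithmic derivative of det(1 - NAz²) as a series of traces. -/

section Det

open PowerSeries

variable {Ω : Type*} [Fintype Ω] [DecidableEq Ω]

/-- The logarithmic derivative of `det (1 - N A z ^ 2)`. -/
lemma X_mul_derivative_det (A : Matrix Ω Ω ℚ) (N : ℚ) :
    (PowerSeries.X : PowerSeries ℚ) * derivative ℚ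
      (1 - (PowerSeries.C N * PowerSeries.X ^ 2) • A.map PowerSeries.C).det =
    - (PowerSeries.mk fun k => if k = 0 then 0 else if Even k then 2 * N ^ (k / 2) *
        (A ^ (k / 2)).trace else 0) *
      (1 - (PowerSeries.C N * PowerSeries.X ^ 2) • A.map PowerSeries.C).det := by
  set t : PowerSeries ℚ := PowerSeries.C N * PowerSeries.X ^ 2
  set M : Matrix Ω Ω (PowerSeries ℚ) := 1 - t • A.map PowerSeries.C with hM
  -- The inverse of `M`: the geometric series of `NAz²`, which lives in even degrees only.
  let T : Matrix Ω Ω (PowerSeries ℚ) := Matrix.of fun i j => PowerSeries.mk fun k =>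
    if Even k then N ^ (k / 2) * (A ^ (k / 2)) i j else 0
  have hMT : M * T = 1 := by
    ext i j k
    rw [hM, sub_mul, one_mul, Matrix.smul_mul]
    simp only [Matrix.sub_apply, Matrix.smul_apply, smul_eq_mul, map_sub, t, mul_assoc,
      coeff_C_mul, coeff_X_pow_mul', Matrix.mul_apply, Matrix.map_apply, map_sum,
      T, Matrix.of_apply, coeff_mk]
    rcases k with _ | _ | k
    · by_cases hij : i = j <;> simp [Matrix.one_apply, hij]
    · by_cases hij : i = j <;> simp [Matrix.one_apply, hij, PowerSeries.coeff_one]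
    · have h1 : coeff (k + 1 + 1) ((1 : Matrix Ω Ω (PowerSeries ℚ)) i j) = 0 := by
        by_cases hij : i = j <;> simp [Matrix.one_apply, hij, PowerSeries.coeff_one]
      rw [h1]
      have h2 : Even (k + 1 + 1) ↔ Even k := by
        simp [Nat.even_add_one]
      have h3 : (k + 1 + 1) / 2 = k / 2 + 1 := by omega
      by_cases hk : Even k
      · simp only [h2, hk, if_true, h3, Nat.le_add_left, pow_succ' A,
          Matrix.mul_apply, Finset.mul_sum, ← Finset.sum_sub_distrib]
        refine Finset.sum_eq_zero fun l _ => ?_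
        simp [hk]
        ring
      · simp [h2, hk]
  have hadj : M.adjugate = M.det • T := by
    calc M.adjugate = M.adjugate * (M * T) := by rw [hMT, mul_one]
      _ = _ := by rw [← mul_assoc, Matrix.adjugate_mul, Matrix.smul_mul, one_mul]
  have hD : M.map (derivative ℚ) = -((PowerSeries.C (2 * N) * PowerSeries.X) •
      A.map PowerSeries.C) := by
    ext1 i j
    have h1 : derivative ℚ ((1 : Matrix Ω Ω (PowerSeries ℚ)) i j) = 0 := by
      by_cases hij : i = j <;> simp [Matrix.one_apply, hij]
    simp [hM, t, h1, mul_assoc]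
    rw [show (PowerSeries.C (2 : ℚ)) = 2 from map_ofNat _ 2]
    ring
  rw [derivation_det, hadj, hD]
  ext k
  simp only [Matrix.smul_mul, Matrix.mul_neg, Matrix.mul_smul, Matrix.trace_neg, Matrix.trace_smul]
  have : (PowerSeries.mk fun k => if k = 0 then 0 else if Even k then 2 * N ^ (k / 2) *
        (A ^ (k / 2)).trace else 0) = PowerSeries.C (2 * N) * PowerSeries.X ^ 2 *
        (T * A.map PowerSeries.C).trace := by
    ext k
    simp only [mul_assoc, coeff_C_mul, coeff_X_pow_mul', coeff_mk, Matrix.trace, Matrix.diag,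
      map_sum, Matrix.mul_apply, T, Matrix.of_apply, Matrix.map_apply, coeff_mul_C]
    rcases k with _ | _ | k
    · simp
    · simp
    · have h2 : Even (k + 1 + 1) ↔ Even k := by
        simp [Nat.even_add_one]
      have h3 : (k + 1 + 1) / 2 = k / 2 + 1 := by omega
      by_cases hk : Even k
      · simp only [h2, hk, if_true, h3, Nat.le_add_left, pow_succ A,
          Matrix.mul_apply, Finset.mul_sum]
        simp only [show k + 1 + 1 - 2 = k from rfl, hk, if_true, Nat.add_eq_zero_iff, one_ne_zero, and_false, if_false]
        refine Finset.sum_congr rfl fun i _ => Finset.sum_congr rfl fun l _ => ?_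
        ring
      · simp [h2, hk]
  rw [this]
  congr 1
  simp only [smul_eq_mul]
  ring

end Det

/-! ### Generating functions of types with a size. -/

section GeneratingFunction

/-- The generating function of a type with a size function. -/
noncomputable def gf {α : Type*} (ℓ : α → ℕ) : PowerSeries ℚ :=
  PowerSeries.mk fun n => (Nat.card {a // ℓ a = n} : ℚ)

lemma gf_eq_of_bijective {α β : Type*} {ℓ : α → ℕ} {ℓ' : β → ℕ} (f : α → β)
    (hf : Function.Bijective f) (h : ∀ a, ℓ' (f a) = ℓ a) : gf ℓ = gf ℓ' := by
  ext n
  simp only [gf, PowerSeries.coeff_mk]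
  rw [Nat.card_congr ((Equiv.ofBijective f hf).subtypeEquiv fun a => by
    simp [h a] : {a // ℓ a = n} ≃ {b // ℓ' b = n})]

lemma gf_sum {α β : Type*} (ℓ : α → ℕ) (ℓ' : β → ℕ) [∀ n, Finite {a // ℓ a = n}]
    [∀ n, Finite {b // ℓ' b = n}] : gf (Sum.elim ℓ ℓ') = gf ℓ + gf ℓ' := by
  ext n
  simp only [gf, PowerSeries.coeff_mk, map_add]
  rw [Nat.card_congr (Equiv.subtypeSum (p := fun x => Sum.elim ℓ ℓ' x = n))]
  simp only [Sum.elim_inl, Sum.elim_inr]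
  rw [Nat.card_sum]
  simp

lemma gf_prod {α β : Type*} (ℓ : α → ℕ) (ℓ' : β → ℕ) [∀ n, Finite {a // ℓ a = n}]
    [∀ n, Finite {b // ℓ' b = n}] :
    gf (fun x : α × β => ℓ x.1 + ℓ' x.2) = gf ℓ * gf ℓ' := by
  ext n
  simp only [gf, PowerSeries.coeff_mk, PowerSeries.coeff_mul]
  have e : {x : α × β // ℓ x.1 + ℓ' x.2 = n} ≃
      Σ ij : Finset.HasAntidiagonal.antidiagonal n, {a // ℓ a = ij.1.1} × {b // ℓ' b = ij.1.2} :=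
    { toFun := fun x => ⟨⟨(ℓ x.1.1, ℓ' x.1.2), by simpa using x.2⟩, ⟨x.1.1, rfl⟩, ⟨x.1.2, rfl⟩⟩
      invFun := fun y => ⟨(y.2.1.1, y.2.2.1), by
        rw [y.2.1.2, y.2.2.2]; exact Finset.HasAntidiagonal.mem_antidiagonal.1 y.1.2⟩
      left_inv := fun x => rfl
      right_inv := by
        rintro ⟨⟨⟨i, j⟩, h⟩, ⟨a, ha⟩, ⟨b, hb⟩⟩
        dsimp at ha hb
        subst ha hb
        rfl }
  rw [Nat.card_congr e, Nat.card_sigma]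
  simp only [Nat.card_prod]
  push_cast
  exact Finset.sum_coe_sort (Finset.HasAntidiagonal.antidiagonal n)
    (fun ij => (Nat.card {a // ℓ a = ij.1} : ℚ) * (Nat.card {b // ℓ' b = ij.2} : ℚ))

lemma gf_const {β : Type*} (k : ℕ) :
    gf (fun _ : β => k) = (Nat.card β : PowerSeries ℚ) * PowerSeries.X ^ k := by
  ext n
  rw [← map_natCast (PowerSeries.C (R := ℚ)), PowerSeries.coeff_C_mul, PowerSeries.coeff_X_pow]
  simp only [gf, PowerSeries.coeff_mk]
  by_cases h : n = k
  · subst h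
    simp
  · simp [h, Ne.symm h]

/-- The fibres depend on the base point but have equal size, so the total space may be replaced by a
product with `Fin c`. -/
lemma gf_sigma {α : Type*} {β : α → Type*} (ℓ : α → ℕ) [∀ n, Finite {a // ℓ a = n}]
    [∀ a, Finite (β a)] {c : ℕ} (hβ : ∀ a, Nat.card (β a) = c) (k : ℕ) :
    gf (fun x : Σ a, β a => ℓ x.1 + k) = gf ℓ * ((c : PowerSeries ℚ) * PowerSeries.X ^ k) := by
  let e : (Σ a, β a) ≃ α × Fin c :=
    (Equiv.sigmaCongrRight fun a => Finite.equivFinOfCardEq (hβ a)).trans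
      (Equiv.sigmaEquivProd _ _)
  have : ∀ x, (e x).1 = x.1 := fun _ => rfl
  rw [gf_eq_of_bijective (ℓ' := fun x : α × Fin c => ℓ x.1 + k) e e.bijective (by simp [this])]
  have : ∀ n, Finite {b : Fin c // k = n} := fun n => inferInstance
  rw [gf_prod ℓ (fun _ : Fin c => k), gf_const]
  simp

/-- Marking one of `n` places multiplies the coefficient of degree `n` by `n`, which is the effect
of the Euler operator. -/
lemma gf_mark {α : Type*} (ℓ : α → ℕ) [∀ n, Finite {a // ℓ a = n}] :
    gf (fun x : Σ a, Fin (ℓ a) => ℓ x.1) =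
      PowerSeries.X * PowerSeries.derivative ℚ (gf ℓ) := by
  ext n
  have e : {x : Σ a, Fin (ℓ a) // ℓ x.1 = n} ≃ {a // ℓ a = n} × Fin n :=
    { toFun := fun x => ⟨⟨x.1.1, x.2⟩, Fin.cast x.2 x.1.2⟩
      invFun := fun y => ⟨⟨y.1.1, Fin.cast y.1.2.symm y.2⟩, y.1.2⟩
      left_inv := fun x => rfl
      right_inv := fun y => rfl }
  cases n with
  | zero => simp [gf, Nat.card_congr e]
  | succ n =>
    rw [PowerSeries.coeff_succ_X_mul, PowerSeries.coeff_derivative]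
    simp [gf, Nat.card_congr e]

end GeneratingFunction

/-! ### Windows of periodic sequences. -/

section Subword

variable {S : Type*} {x y : ℤ → S} {k : ℕ}

@[simp] lemma length_subword (x : ℤ → S) (i : ℤ) (n : ℕ) : (subword x i n).length = n := by
  simp [subword]

@[simp] lemma getElem_subword (x : ℤ → S) (i : ℤ) (n m : ℕ) (h : m < (subword x i n).length) :
    (subword x i n)[m] = x (i + m) := by
  simp [subword]

@[simp] lemma subword_zero (x : ℤ → S) (i : ℤ) : subword x i 0 = [] := rfl

lemma subword_add (x : ℤ → S) (i : ℤ) (m n : ℕ) :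
    subword x i (m + n) = subword x i m ++ subword x (i + m) n := by
  refine List.ext_getElem (by simp) fun l h₁ h₂ => ?_
  rw [List.getElem_append]
  split_ifs with h
  · simp
  · simp only [length_subword, not_lt] at h
    simp only [getElem_subword, length_subword]
    congr 1
    push_cast [h]
    ring

lemma subword_succ (x : ℤ → S) (i : ℤ) (n : ℕ) :
    subword x i (n + 1) = subword x i n ++ [x (i + n)] := by
  rw [subword_add]; simp [subword]

lemma subword_succ' (x : ℤ → S) (i : ℤ) (n : ℕ) :
    subword x i (n + 1) = x i :: subword x (i + 1) n := by
  rw [add_comm, subword_add]; simp [subword]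

lemma subword_periodic (hx : Function.Periodic x (k : ℤ)) (i : ℤ) (n : ℕ) :
    subword x (i + k) n = subword x i n := by
  refine List.ext_getElem (by simp) fun l h₁ h₂ => ?_
  simp only [getElem_subword]
  rw [← hx (i + l)]
  congr 1; ring

lemma subword_congr_emod (hx : Function.Periodic x (k : ℤ)) {i j : ℤ} (h : (k : ℤ) ∣ i - j)
    (n : ℕ) : subword x i n = subword x j n := by
  obtain ⟨m, hm⟩ := h
  refine List.ext_getElem (by simp) fun l h₁ h₂ => ?_
  simp only [getElem_subword]
  rw [show i + (l : ℤ) = j + l + m * k by linear_combination hm]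
  exact hx.int_mul m _

lemma eq_of_subword_eq (hx : Function.Periodic x (k : ℤ)) (hy : Function.Periodic y (k : ℤ))
    (hk : k ≠ 0) {i : ℤ} (h : subword x i k = subword y i k) : x = y := by
  ext a
  have hk' : (0 : ℤ) < k := by positivity
  obtain ⟨m, hm⟩ : ∃ m : ℕ, (m : ℤ) = (a - i) % k :=
    ⟨((a - i) % k).toNat, Int.toNat_of_nonneg (Int.emod_nonneg _ hk'.ne')⟩
  have hmk : m < k := by
    have := Int.emod_lt_of_pos (a - i) hk'
    omega
  have ha : a = i + m + ((a - i) / k) * k := by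
    have := Int.emod_add_mul_ediv (a - i) k
    rw [hm]; linear_combination -this
  have hxy : x (i + m) = y (i + m) := by
    rw [← getElem_subword x i k m (by simpa using hmk),
      ← getElem_subword y i k m (by simpa using hmk)]
    simp only [h]
  rw [ha]
  exact (hx.int_mul _ _).trans (hxy.trans (hy.int_mul _ _).symm)

lemma exists_periodic (r : List S) (hr : r ≠ []) (i : ℤ) :
    ∃ x : ℤ → S, Function.Periodic x (r.length : ℤ) ∧ subword x i r.length = r := by
  have hk : (0 : ℤ) < r.length := by
    have := List.length_pos_iff.2 hr
    positivity
  refine ⟨fun a => r[((a - i) % r.length).toNat]'?_, fun a => ?_, ?_⟩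
  · have h₁ := Int.emod_lt_of_pos (a - i) hk
    have h₂ := Int.emod_nonneg (a - i) hk.ne'
    omega
  · simp only
    congr 2
    rw [add_sub_right_comm, Int.add_emod_right]
  · refine List.ext_getElem (by simp) fun l h₁ h₂ => ?_
    rw [getElem_subword]
    congr 1
    rw [add_sub_cancel_left, Int.emod_eq_of_lt (by positivity) (by exact_mod_cast h₂)]
    simp

end Subword

/-! ### Circular words of very pure monoids. -/

section Circular

variable {S : Type*}

/-- A very pure submonoid of a free monoid. -/
structure VeryPure (M : Set (List S)) : Prop where
  nil : [] ∈ M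
  append {u v : List S} : u ∈ M → v ∈ M → u ++ v ∈ M
  pure {u v : List S} : u ++ v ∈ M → v ++ u ∈ M → u ∈ M

/-- The points of period `n` that repeat a conjugate of a word in `M`. -/
def circ (M : Set (List S)) (n : ℕ) : Set (ℤ → S) :=
  {x | Function.Periodic x (n : ℤ) ∧ ∃ i, subword x i n ∈ M}

/-- The points in `circ M n`, `n ≥ 1`, together with `n`. -/
abbrev Circ (M : Set (List S)) : Type _ := Σ n : {n : ℕ // n ≠ 0}, circ M n.1

variable {M : Set (List S)}

lemma exists_offset (c : Circ M) : ∃ j : ℕ, subword c.2.1 (-j) c.1.1 ∈ M := by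
  obtain ⟨⟨n, hn⟩, x, hx, i, hi⟩ := c
  have hn' : (n : ℤ) ≠ 0 := by exact_mod_cast hn
  refine ⟨((-i) % n).toNat, ?_⟩
  rw [Int.toNat_of_nonneg (Int.emod_nonneg _ hn')]
  dsimp only
  rw [subword_congr_emod hx (j := i)]
  · exact hi
  · refine ⟨(-i) / n, ?_⟩
    linear_combination - Int.emod_add_mul_ediv (-i) n

open Classical in
/-- The distance of the origin to the last position before it where a word of `M` starts. -/
noncomputable def offset (c : Circ M) : ℕ := Nat.find (exists_offset c)

lemma offset_spec (c : Circ M) : subword c.2.1 (-(offset c : ℕ)) c.1.1 ∈ M := by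
  classical exact Nat.find_spec (exists_offset c)

lemma offset_min (c : Circ M) {j : ℕ} (h : subword c.2.1 (-j) c.1.1 ∈ M) : offset c ≤ j := by
  classical exact Nat.find_min' (exists_offset c) h

lemma offset_lt (c : Circ M) : offset c < c.1.1 := by
  by_contra! h
  have : subword c.2.1 (-((offset c - c.1.1 : ℕ) : ℤ)) c.1.1 ∈ M := by
    rw [subword_congr_emod c.2.2.1 (j := -(offset c : ℕ))]
    · exact offset_spec c
    · refine ⟨1, ?_⟩
      push_cast [h]; ring
  have := offset_min c this
  have := Nat.pos_of_ne_zero c.1.2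
  omega

/-- The marked word of `M` that is obtained by concatenating a word of `M` and a circular word. -/
noncomputable def markedWord (hM : VeryPure M) (y : Circ M × M) : Σ w : M, Fin w.1.length :=
  ⟨⟨y.2.1 ++ subword y.1.2.1 (-(offset y.1 : ℕ)) y.1.1.1, hM.append y.2.2 (offset_spec y.1)⟩,
    ⟨y.2.1.length + offset y.1, by simpa using offset_lt y.1⟩⟩

lemma subword_rotate {x : ℤ → S} {k : ℕ} (hx : Function.Periodic x (k : ℤ)) {i : ℤ}
    {a b : List S} (h : subword x i k = a ++ b) : subword x (i + a.length) k = b ++ a := by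
  have hk : k = a.length + b.length := by simpa using congrArg List.length h
  have h' := h
  rw [hk, subword_add] at h'
  obtain ⟨h₁, h₂⟩ := List.append_inj h' (by simp)
  have : subword x (i + a.length) k = subword x (i + a.length) (b.length + a.length) := by
    rw [hk, add_comm b.length]
  rw [this, subword_add, h₂, add_assoc, ← Nat.cast_add, ← hk, subword_periodic hx, h₁]

/-- If the two prefixes differ by `s`, then `s` begins one product of words in `M` and ends its
rotation, so purity puts `s` in `M`. This gives `c₁` a cut nearer to its origin than `offset c₁`,
unless `s` is empty. -/
lemma eq_of_markedWord_eq (hM : VeryPure M) {y₁ y₂ : Circ M × M}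
    (h : markedWord hM y₁ = markedWord hM y₂) (hle : y₁.2.1.length ≤ y₂.2.1.length) :
    y₁ = y₂ := by
  obtain ⟨c₁, w₁, hw₁⟩ := y₁
  obtain ⟨c₂, w₂, hw₂⟩ := y₂
  dsimp only at hle
  have hw : w₁ ++ subword c₁.2.1 (-(offset c₁ : ℕ)) c₁.1.1 =
      w₂ ++ subword c₂.2.1 (-(offset c₂ : ℕ)) c₂.1.1 :=
    congrArg (fun z : Σ w : M, Fin w.1.length => z.1.1) h
  have hi : w₁.length + offset c₁ = w₂.length + offset c₂ :=
    congrArg (fun z : Σ w : M, Fin w.1.length => z.2.1) h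
  obtain ⟨s, rfl⟩ : ∃ s, w₂ = w₁ ++ s := by
    have : w₁ <+: w₂ := List.prefix_of_prefix_length_le ⟨_, hw⟩ ⟨_, rfl⟩ hle
    obtain ⟨s, hs⟩ := this
    exact ⟨s, hs.symm⟩
  rw [List.append_assoc, List.append_cancel_left_eq] at hw
  have hs : s ∈ M := by
    refine hM.pure (v := subword c₂.2.1 (-(offset c₂ : ℕ)) c₂.1.1 ++ w₁) ?_ ?_
    · rw [← List.append_assoc, ← hw]
      exact hM.append (offset_spec c₁) hw₁
    · rw [List.append_assoc]
      exact hM.append (offset_spec c₂) hw₂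
  have hrot := subword_rotate c₁.2.2.1 hw
  rw [List.length_append] at hi
  have h₁ : offset c₁ = s.length + offset c₂ := by omega
  have h₂ : subword c₁.2.1 (-(offset c₂ : ℕ)) c₁.1.1 ∈ M := by
    rw [show -((offset c₂ : ℕ) : ℤ) = -((offset c₁ : ℕ) : ℤ) + s.length by rw [h₁]; push_cast; ring,
      hrot]
    exact hM.append (offset_spec c₂) hs
  have h₃ := offset_min c₁ h₂
  obtain rfl : s = [] := List.length_eq_zero_iff.1 (by omega)
  have h₄ : offset c₁ = offset c₂ := by simpa using h₁
  rw [List.nil_append, h₄] at hw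
  obtain ⟨⟨n₁, hn₁⟩, x₁, hx₁⟩ := c₁
  obtain ⟨⟨n₂, hn₂⟩, x₂, hx₂⟩ := c₂
  obtain rfl : n₁ = n₂ := by simpa using congrArg List.length hw
  obtain rfl : x₁ = x₂ := eq_of_subword_eq hx₁.1 hx₂.1 hn₁ hw
  simp

lemma markedWord_injective (hM : VeryPure M) : Function.Injective (markedWord hM) := by
  intro y₁ y₂ h
  rcases le_total y₁.2.1.length y₂.2.1.length with hle | hle
  · exact eq_of_markedWord_eq hM h hle
  · exact (eq_of_markedWord_eq hM h.symm hle).symm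

/-- Cut the marked word at the last place before or at the mark where both parts lie in `M`, and
repeat the right part periodically with the origin at the mark. -/
lemma markedWord_surjective (hM : VeryPure M) : Function.Surjective (markedWord hM) := by
  classical
  rintro ⟨⟨w, hw⟩, i, hi⟩
  dsimp only at hi
  let P : ℕ → Prop := fun s => w.take s ∈ M ∧ w.drop s ∈ M
  have hP0 : P 0 := ⟨by simpa using hM.nil, by simpa using hw⟩
  set s := Nat.findGreatest P i with hs
  have hPs : P s := Nat.findGreatest_spec (Nat.zero_le i) hP0
  have hsi : s ≤ i := Nat.findGreatest_le i
  have hlen : (w.drop s).length = w.length - s := List.length_drop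
  have hne : w.drop s ≠ [] := by
    rw [← List.length_pos_iff, hlen]; omega
  obtain ⟨x, hx, hxr⟩ := exists_periodic (w.drop s) hne (-((i - s : ℕ) : ℤ))
  set k := (w.drop s).length with hk
  let c : Circ M := ⟨⟨k, by omega⟩, x, hx, _, by rw [hxr]; exact hPs.2⟩
  have hc : offset c = i - s := by
    have hle : offset c ≤ i - s := offset_min c (by change subword x _ k ∈ M; rw [hxr]; exact hPs.2)
    by_contra hcon
    have hlt : offset c < i - s := by omega
    set d := i - s - offset c with hd
    have hspec : subword x (-(offset c : ℕ)) k ∈ M := offset_spec c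
    have hsplit : w.drop s = (w.drop s).take d ++ (w.drop s).drop d := (List.take_append_drop _ _).symm
    have hdlen : ((w.drop s).take d).length = d := by
      rw [List.length_take]; omega
    have hrot := subword_rotate hx (hxr.trans hsplit)
    rw [hdlen, show -((i - s : ℕ) : ℤ) + d = -(offset c : ℕ) by omega] at hrot
    rw [hrot] at hspec
    -- A cut nearer to the origin would put both cyclic orders of the two pieces in `M`. By purity
    -- each piece is in `M`, which contradicts the maximality of `s`.
    have h₁ := hM.pure (hsplit ▸ hPs.2) hspec
    have h₂ := hM.pure hspec (hsplit ▸ hPs.2)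
    have : P (s + d) := by
      refine ⟨?_, ?_⟩
      · rw [List.take_add]; exact hM.append hPs.1 h₁
      · rwa [← List.drop_drop]
    have := Nat.le_findGreatest (P := P) (n := i) (by omega) this
    omega
  refine ⟨(c, ⟨w.take s, hPs.1⟩), ?_⟩
  have hword : w.take s ++ subword c.2.1 (-(offset c : ℕ)) c.1.1 = w := by
    rw [hc]; change w.take s ++ subword x _ k = w; rw [hxr, List.take_append_drop]
  refine Sigma.ext (Subtype.ext hword) ?_
  refine (Fin.heq_ext_iff (congrArg List.length hword)).2 ?_
  change (w.take s).length + offset c = i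
  rw [hc, List.length_take]
  omega

lemma finite_length_eq [Finite S] (M : Set (List S)) (n : ℕ) :
    Finite {w : M // w.1.length = n} := by
  have := (List.finite_length_eq S n).to_subtype
  exact Finite.of_injective (β := {w : List S | w.length = n}) (fun w => ⟨w.1.1, w.2⟩)
    fun a b h => Subtype.ext (Subtype.ext (congrArg (fun z : {w : List S | w.length = n} => z.1) h))

lemma finite_periodic [Finite S] {n : ℕ} (hn : n ≠ 0) :
    {x : ℤ → S | Function.Periodic x (n : ℤ)}.Finite := by
  have := List.finite_length_eq S n
  refine Set.Finite.of_finite_image (f := fun x => subword x 0 n)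
    (this.subset (by rintro _ ⟨x, -, rfl⟩; simp)) ?_
  intro x hx y hy h
  exact eq_of_subword_eq hx hy hn h

/-- The generating function of a set of words by length. -/
noncomputable def wordSeries (M : Set (List S)) : PowerSeries ℚ := gf fun w : M => w.1.length

/-- The generating function of the circular words of `M`. -/
noncomputable def circSeries (M : Set (List S)) : PowerSeries ℚ :=
  PowerSeries.mk fun n => if n = 0 then 0 else ((circ M n).ncard : ℚ)

lemma mem_circ_congr {m n : ℕ} (h : m = n) {x : ℤ → S} (hx : x ∈ circ M m) : x ∈ circ M n :=
  h ▸ hx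

lemma gf_circ (M : Set (List S)) : gf (fun c : Circ M => c.1.1) = circSeries M := by
  ext n
  simp only [gf, circSeries, PowerSeries.coeff_mk]
  split_ifs with h
  · have : IsEmpty {c : Circ M // c.1.1 = n} := ⟨fun c => c.1.1.2 (c.2.trans h)⟩
    simp
  · rw [← Nat.card_coe_set_eq]
    let e : {c : Circ M // c.1.1 = n} ≃ circ M n :=
      { toFun := fun c => ⟨c.1.2.1, mem_circ_congr c.2 c.1.2.2⟩
        invFun := fun x => ⟨⟨⟨n, h⟩, x⟩, rfl⟩
        left_inv := by
          rintro ⟨⟨⟨m, hm⟩, x⟩, rfl⟩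
          rfl
        right_inv := fun x => rfl }
    rw [Nat.card_congr e]

/-- The logarithmic derivative of the generating function of a very pure submonoid counts the
circular words. -/
theorem circSeries_mul [Finite S] (hM : VeryPure M) :
    PowerSeries.X * PowerSeries.derivative ℚ (wordSeries M) = circSeries M * wordSeries M := by
  have := finite_length_eq M
  have : ∀ n, Finite {c : Circ M // c.1.1 = n} := by
    intro n
    rcases eq_or_ne n 0 with rfl | hn
    · have : IsEmpty {c : Circ M // c.1.1 = 0} := ⟨fun c => c.1.1.2 c.2⟩
      infer_instance
    · have := (finite_periodic (S := S) hn).to_subtype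
      refine Finite.of_injective (β := {x : ℤ → S | Function.Periodic x (n : ℤ)})
        (fun c => ⟨c.1.2.1, (mem_circ_congr c.2 c.1.2.2).1⟩) ?_
      rintro ⟨⟨⟨m, hm⟩, x, hx⟩, rfl⟩ ⟨⟨⟨m', hm'⟩, y, hy⟩, h⟩ hxy
      dsimp at h
      subst h
      obtain rfl : x = y := congrArg Subtype.val hxy
      rfl
  rw [wordSeries, ← gf_mark, ← gf_circ, ← gf_prod]
  symm
  refine gf_eq_of_bijective (markedWord hM) ⟨markedWord_injective hM, markedWord_surjective hM⟩ ?_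
  intro y
  simp [markedWord, add_comm]

end Circular

/-! ### The Dyck inverse monoid is not trivial. -/

section Monoid

variable {Γ : Type*}

lemma dyck_zero_mul (a : DyckMonoid Γ) : 0 * a = 0 := by
  induction a using Con.induction_on with
  | _ a => exact congrArg _ (zero_mul a)

lemma dyck_mul_zero (a : DyckMonoid Γ) : a * 0 = 0 := by
  induction a using Con.induction_on with
  | _ a => exact congrArg _ (mul_zero a)

lemma dyck_neg_mul_pos_self (γ : Γ) : (Gen.neg γ).toDyck * (Gen.pos γ).toDyck = 1 :=
  (Con.eq _).2 (ConGen.Rel.of _ _ (DyckRel.same γ))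

lemma dyck_neg_mul_pos_of_ne {γ γ' : Γ} (h : γ ≠ γ') :
    (Gen.neg γ).toDyck * (Gen.pos γ').toDyck = 0 :=
  (Con.eq _).2 (ConGen.Rel.of _ _ (DyckRel.diff γ γ' h))

open Classical in
/-- The generators as linear maps: `γ(+)` puts `γ` on a stack, `γ(-)` removes it. -/
noncomputable def Gen.toEnd : Gen Γ → Module.End ℤ (List Γ →₀ ℤ)
  | .pos γ => Finsupp.linearCombination ℤ fun l => Finsupp.single (γ :: l) 1
  | .neg γ => Finsupp.linearCombination ℤ fun l =>
      match l with
      | [] => 0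
      | a :: l => if a = γ then Finsupp.single l 1 else 0

/-- The representation of the free monoid with zero by linear maps. -/
noncomputable def wordToEnd : WithZero (FreeMonoid (Gen Γ)) →*₀ Module.End ℤ (List Γ →₀ ℤ) :=
  WithZero.lift' (FreeMonoid.lift Gen.toEnd)

lemma wordToEnd_word (a : Gen Γ) : wordToEnd a.word = a.toEnd := by
  simp [wordToEnd, Gen.word]

/-- The defining relations hold for the operators that push letters on a stack and remove them.
These operators act on a nonzero module, so 1 and 0 are not identified. -/
lemma dyck_one_ne_zero : (1 : DyckMonoid Γ) ≠ 0 := by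
  intro h
  have hle : conGen (DyckRel Γ) ≤ Con.ker (wordToEnd (Γ := Γ)) := by
    refine Con.conGen_le.2 ?_
    rintro _ _ (γ | ⟨γ, γ', h⟩)
    · refine (Con.ker_rel _).2 ?_
      rw [map_mul, wordToEnd_word, wordToEnd_word, map_one]
      ext1 l
      ext1
      simp [Gen.toEnd]
    · refine (Con.ker_rel _).2 ?_
      rw [map_mul, wordToEnd_word, wordToEnd_word, map_zero]
      ext1 l
      ext1
      simp [Gen.toEnd, h.symm]
  have h' : wordToEnd (1 : WithZero (FreeMonoid (Gen Γ))) = wordToEnd 0 :=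
    (Con.ker_rel _).1 (hle ((Con.eq _).1 h))
  rw [map_one, map_zero] at h'
  exact one_ne_zero h'

end Monoid

/-! ### Normal forms and matching of brackets. -/

section Run

variable {Γ Ω : Type*}

open Classical in
/-- The action of a symbol on the normal form of a word. The normal form consists of the unmatched
`γ(+)` and of the unmatched `γ(-)`, the last ones first. -/
noncomputable def push : Option (List Γ × List Γ) → Symbol Γ Ω → Option (List Γ × List Γ)
  | none, _ => none
  | some x, .loop _ => some x
  | some (p, q), .neg γ => some (p, γ :: q)
  | some (p, []), .pos γ => some (γ :: p, [])
  | some (p, a :: q), .pos γ => if a = γ then some (p, q) else none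

/-- The normal form of a word. -/
noncomputable def run (w : List (Symbol Γ Ω)) : Option (List Γ × List Γ) :=
  w.foldl push (some ([], []))

@[simp] lemma run_nil : run ([] : List (Symbol Γ Ω)) = some ([], []) := rfl

lemma run_append (u v : List (Symbol Γ Ω)) : run (u ++ v) = v.foldl push (run u) :=
  List.foldl_append

lemma run_concat (w : List (Symbol Γ Ω)) (s : Symbol Γ Ω) : run (w ++ [s]) = push (run w) s := by
  simp [run]

@[simp] lemma push_loop (x : Option (List Γ × List Γ)) (ω : Ω) : push x (.loop ω) = x := by
  cases x <;> rfl

@[simp] lemma push_neg (p q : List Γ) (γ : Γ) :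
    push (some (p, q)) (.neg γ : Symbol Γ Ω) = some (p, γ :: q) := rfl

@[simp] lemma push_pos_nil (p : List Γ) (γ : Γ) :
    push (some (p, [])) (.pos γ : Symbol Γ Ω) = some (γ :: p, []) := rfl

@[simp] lemma push_pos_cons (p q : List Γ) (γ : Γ) :
    push (some (p, γ :: q)) (.pos γ : Symbol Γ Ω) = some (p, q) := by
  simp [push]

@[simp] lemma push_none (s : Symbol Γ Ω) : push none s = none := rfl

lemma push_eq_some {x : Option (List Γ × List Γ)} {s : Symbol Γ Ω} {p q : List Γ}
    (h : push x s = some (p, q)) :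
    (∃ ω, s = .loop ω ∧ x = some (p, q)) ∨
    (∃ γ q', s = .neg γ ∧ q = γ :: q' ∧ x = some (p, q')) ∨
    (∃ γ p', s = .pos γ ∧ q = [] ∧ p = γ :: p' ∧ x = some (p', [])) ∨
    (∃ γ, s = .pos γ ∧ x = some (p, γ :: q)) := by
  rcases x with _ | ⟨p', q'⟩
  · simp at h
  cases s with
  | loop ω => left; simpa using h
  | neg γ => right; left; simp at h; exact ⟨γ, q', rfl, h.2.symm, by rw [h.1]⟩
  | pos γ =>
    cases q' with
    | nil => right; right; left; simp at h; exact ⟨γ, p', rfl, h.2, h.1.symm, rfl⟩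
    | cons a q' =>
      right; right; right
      simp only [push] at h
      split_ifs at h with hc
      subst hc
      simp at h
      exact ⟨a, rfl, by rw [h.1, h.2]⟩

/-- The product of the `γ(+)` in the first part of a normal form. -/
def posValue : List Γ → DyckMonoid Γ
  | [] => 1
  | γ :: p => posValue p * (Gen.pos γ).toDyck

/-- The product of the `γ(-)` in the second part of a normal form. -/
def negValue : List Γ → DyckMonoid Γ
  | [] => 1
  | γ :: q => negValue q * (Gen.neg γ).toDyck

/-- Products of γ(+) are left invertible and products of γ(-) right invertible, so the value of a
normal form can be multiplied to 1 from its two sides. -/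
lemma exists_mul_posValue (p : List Γ) : ∃ r, r * posValue p = 1 := by
  induction p with
  | nil => exact ⟨1, mul_one 1⟩
  | cons γ p ih =>
    obtain ⟨r, hr⟩ := ih
    exact ⟨(Gen.neg γ).toDyck * r, by
      rw [posValue, mul_assoc, ← mul_assoc r, hr, one_mul, dyck_neg_mul_pos_self]⟩

lemma exists_negValue_mul (q : List Γ) : ∃ r, negValue q * r = 1 := by
  induction q with
  | nil => exact ⟨1, mul_one 1⟩
  | cons γ q ih =>
    obtain ⟨r, hr⟩ := ih
    exact ⟨(Gen.pos γ).toDyck * r, by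
      rw [negValue, mul_assoc, ← mul_assoc (Gen.neg γ).toDyck, dyck_neg_mul_pos_self, one_mul, hr]⟩

/-- The value of a normal form in the Dyck inverse monoid. -/
def normalValue : Option (List Γ × List Γ) → DyckMonoid Γ
  | none => 0
  | some (p, q) => posValue p * negValue q

lemma normalValue_push (x : Option (List Γ × List Γ)) (s : Symbol Γ Ω) :
    normalValue (push x s) = normalValue x * s.toDyck := by
  rcases x with _ | ⟨p, q⟩
  · exact (dyck_zero_mul _).symm
  cases s with
  | loop ω => simp [Symbol.toDyck]
  | neg γ => simp [Symbol.toDyck, normalValue, negValue, mul_assoc]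
  | pos γ =>
    cases q with
    | nil => simp [Symbol.toDyck, normalValue, negValue, posValue]
    | cons a q =>
      by_cases h : a = γ
      · subst h
        simp [Symbol.toDyck, normalValue, negValue, mul_assoc, dyck_neg_mul_pos_self]
      · simp [push, h, Symbol.toDyck, normalValue, negValue, mul_assoc,
          dyck_neg_mul_pos_of_ne h, dyck_mul_zero]

lemma normalValue_run (w : List (Symbol Γ Ω)) :
    normalValue (run w) = (w.map Symbol.toDyck).prod := by
  induction w using List.reverseRecOn with
  | nil => simp [normalValue, posValue, negValue]
  | append_singleton w s ih => rw [run_concat, normalValue_push, ih]; simp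

lemma admissible_iff {w : List (Symbol Γ Ω)} : Admissible w ↔ ∃ p q, run w = some (p, q) := by
  rw [Admissible, ← normalValue_run]
  rcases h : run w with _ | ⟨p, q⟩
  · simp [normalValue]
  · simp only [normalValue, Option.some.injEq, Prod.mk.injEq, exists_and_left, exists_eq', and_true,
      iff_true]
    intro h0
    obtain ⟨r, hr⟩ := exists_mul_posValue p
    obtain ⟨r', hr'⟩ := exists_negValue_mul q
    apply dyck_one_ne_zero (Γ := Γ)
    calc (1 : DyckMonoid Γ) = (r * posValue p) * (negValue q * r') := by rw [hr, hr', mul_one]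
      _ = r * (posValue p * negValue q) * r' := by simp only [mul_assoc]
      _ = 0 := by rw [h0, dyck_mul_zero, dyck_zero_mul]

lemma Admissible.infix {u w : List (Symbol Γ Ω)} (hw : Admissible w) (h : u <:+: w) :
    Admissible u := by
  obtain ⟨a, b, rfl⟩ := h
  intro h0
  apply hw
  rw [List.map_append, List.map_append, List.prod_append, List.prod_append, h0, dyck_mul_zero,
    dyck_zero_mul]

/-- With no γ(-) waiting to be matched, `v` is read as if from the start, and its unmatched γ(+) are
stacked on `p`. -/
lemma foldl_push_of_nil_right {v : List (Symbol Γ Ω)} {p' q' : List Γ}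
    (h : run v = some (p', q')) (p : List Γ) :
    v.foldl push (some (p, [])) = some (p' ++ p, q') := by
  induction v using List.reverseRecOn generalizing p' q' with
  | nil => simp at h; simp [h]
  | append_singleton v s ih =>
    rw [run_concat] at h
    rw [List.foldl_concat]
    rcases push_eq_some h with ⟨ω, rfl, hv⟩ | ⟨γ, q'', rfl, rfl, hv⟩ | ⟨γ, p'', rfl, rfl, rfl, hv⟩ |
      ⟨γ, rfl, hv⟩ <;> simp [ih hv]

/-- Every γ(+) of `v` has its partner inside `v`, so the waiting letters `q` stay untouched. -/
lemma foldl_push_of_nil_left {v : List (Symbol Γ Ω)} {q' : List Γ}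
    (h : run v = some ([], q')) (p q : List Γ) :
    v.foldl push (some (p, q)) = some (p, q' ++ q) := by
  induction v using List.reverseRecOn generalizing q' with
  | nil => simp at h; simp [h]
  | append_singleton v s ih =>
    rw [run_concat] at h
    rw [List.foldl_concat]
    rcases push_eq_some h with ⟨ω, rfl, hv⟩ | ⟨γ, q'', rfl, rfl, hv⟩ | ⟨γ, p'', rfl, rfl, h0, hv⟩ |
      ⟨γ, rfl, hv⟩
    · simp [ih hv]
    · simp [ih hv]
    · simp at h0
    · simp [ih hv]

lemma length_le_of_foldl_push {v : List (Symbol Γ Ω)} {p q p' q' : List Γ}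
    (h : v.foldl push (some (p, q)) = some (p', q')) : p.length ≤ p'.length := by
  induction v using List.reverseRecOn generalizing p' q' with
  | nil => simp at h; simp [h]
  | append_singleton v s ih =>
    rw [List.foldl_concat] at h
    rcases push_eq_some h with ⟨ω, rfl, hv⟩ | ⟨γ, q'', rfl, rfl, hv⟩ | ⟨γ, p'', rfl, rfl, rfl, hv⟩ |
      ⟨γ, rfl, hv⟩
    · exact ih hv
    · exact ih hv
    · have := ih hv
      simp; omega
    · exact ih hv

lemma foldl_push_none (v : List (Symbol Γ Ω)) : v.foldl push none = none := by
  induction v with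
  | nil => rfl
  | cons s v ih => simpa using ih

/-- The cut is made right after the last unmatched γ(+). -/
lemma exists_split_of_run {w : List (Symbol Γ Ω)} {p q : List Γ} (h : run w = some (p, q)) :
    ∃ u v, w = u ++ v ∧ run u = some (p, []) ∧ run v = some ([], q) := by
  induction w using List.reverseRecOn generalizing p q with
  | nil => simp at h; exact ⟨[], [], by simp [h]⟩
  | append_singleton w s ih =>
    rw [run_concat] at h
    rcases push_eq_some h with ⟨ω, rfl, hv⟩ | ⟨γ, q'', rfl, rfl, hv⟩ | ⟨γ, p'', rfl, rfl, rfl, hv⟩ |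
      ⟨γ, rfl, hv⟩
    · obtain ⟨u, v, rfl, hu, hv⟩ := ih hv
      exact ⟨u, v ++ [.loop ω], by simp, hu, by simp [run_concat, hv]⟩
    · obtain ⟨u, v, rfl, hu, hv⟩ := ih hv
      exact ⟨u, v ++ [.neg γ], by simp, hu, by simp [run_concat, hv]⟩
    · exact ⟨w ++ [.pos γ], [], by simp, by simp [run_concat, hv], rfl⟩
    · obtain ⟨u, v, rfl, hu, hv⟩ := ih hv
      exact ⟨u, v ++ [.pos γ], by simp, hu, by simp [run_concat, hv]⟩

/-- The last unmatched `γ(-)` of a word. -/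
lemma exists_match_of_run {w : List (Symbol Γ Ω)} {p q : List Γ} {γ : Γ}
    (h : run w = some (p, γ :: q)) :
    ∃ t u, w = t ++ .neg γ :: u ∧ run t = some (p, q) ∧ run u = some ([], []) := by
  induction hn : w.length using Nat.strong_induction_on generalizing w p q γ with
  | _ n ih =>
    rcases List.eq_nil_or_concat w with rfl | ⟨w, s, rfl⟩
    · simp at h
    rw [List.concat_eq_append] at *
    rw [run_concat] at h
    simp only [List.length_append, List.length_singleton] at hn
    rcases push_eq_some h with ⟨ω, rfl, hv⟩ | ⟨γ', q'', rfl, hq, hv⟩ |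
      ⟨γ', p'', rfl, h0, rfl, hv⟩ | ⟨γ', rfl, hv⟩
    · obtain ⟨t, u, rfl, ht, hu⟩ := ih _ (by omega) hv rfl
      exact ⟨t, u ++ [.loop ω], by simp, ht, by simp [run_concat, hu]⟩
    · simp at hq
      obtain ⟨rfl, rfl⟩ := hq
      exact ⟨w, [], rfl, hv, rfl⟩
    · simp at h0
    -- The last letter γ'(+) hides one more unmatched letter: the first application finds its
    -- partner γ'(-), and the second finds the γ(-) beneath.
    · obtain ⟨t, u, rfl, ht, hu⟩ := ih _ (by omega) hv rfl
      obtain ⟨t', u', rfl, ht', hu'⟩ := ih _ (by simp at hn; omega) ht rfl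
      refine ⟨t', u' ++ .neg γ' :: u ++ [.pos γ'], by simp, ht', ?_⟩
      rw [run_concat, List.append_cons, run_append, run_concat, hu', push_neg,
        foldl_push_of_nil_left hu]
      simp

lemma not_suffix_of_run {u x : List (Symbol Γ Ω)} {γ : Γ}
    (hu : run u = some ([], [])) : run (x ++ .neg γ :: u) ≠ some ([], []) := by
  intro h
  rw [List.append_cons, run_append, run_concat] at h
  rcases hx : run x with _ | ⟨p, q⟩
  · simp [hx, foldl_push_none] at h
  · rw [hx, push_neg, foldl_push_of_nil_left hu] at h
    simp at h

/-- If the two starting places differed, one balanced tail would contain the other γ(-), followed by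
a balanced word, hence unmatched. -/
lemma match_unique {t u t' u' : List (Symbol Γ Ω)} {γ γ' : Γ} (hu : run u = some ([], []))
    (hu' : run u' = some ([], [])) (h : t ++ .neg γ :: u = t' ++ .neg γ' :: u') :
    t = t' ∧ γ = γ' ∧ u = u' := by
  rcases List.append_eq_append_iff.1 h with ⟨a, rfl, ha⟩ | ⟨a, rfl, ha⟩
  · cases a with
    | nil => simpa using ha
    | cons s a =>
      simp at ha
      rw [ha.2] at hu
      exact absurd hu (not_suffix_of_run hu')
  · cases a with
    | nil => simp at ha; simp [ha]
    | cons s a =>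
      simp at ha
      rw [ha.2] at hu'
      exact absurd hu' (not_suffix_of_run hu)

/-- The waiting γ(-) meet the unmatched γ(+) of `v`. Either they absorb all of these, and what is
left of them lies under `q`, or they are used up and only `q` remains. -/
lemma foldl_push_alternative {v : List (Symbol Γ Ω)} {p q q₀ a b : List Γ}
    (h : run v = some (p, q)) (h' : v.foldl push (some ([], q₀)) = some (a, b)) :
    (a = [] ∧ ∃ r, b = q ++ r) ∨ b = q := by
  induction v using List.reverseRecOn generalizing p q a b with
  | nil => simp at h h'; simp [h, h']
  | append_singleton v s ih =>
    rw [run_concat] at h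
    rw [List.foldl_concat] at h'
    rcases push_eq_some h with ⟨ω, rfl, hv⟩ | ⟨γ, q'', rfl, rfl, hv⟩ | ⟨γ, p'', rfl, rfl, rfl, hv⟩ |
      ⟨γ, rfl, hv⟩ <;>
    rcases push_eq_some h' with ⟨ω', h1, hv'⟩ | ⟨γ', q''', h1, rfl, hv'⟩ |
      ⟨γ', p''', h1, rfl, rfl, hv'⟩ | ⟨γ', h1, hv'⟩ <;> simp at h1 <;>
    have := ih hv hv' <;> simp_all

/-- Split off the part with the unmatched γ(+) and move it behind the part with the unmatched γ(-).
The cancellation then exhausts at least one of the two. -/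
lemma run_rotate {w : List (Symbol Γ Ω)} {p q : List Γ} (h : run w = some (p, q)) :
    ∃ u v, w = u ++ v ∧ (Admissible (v ++ u) →
      (∃ q', run (v ++ u) = some ([], q')) ∨ ∃ p', run (v ++ u) = some (p', [])) := by
  obtain ⟨u, v, rfl, hu, hv⟩ := exists_split_of_run h
  refine ⟨u, v, rfl, fun hadm => ?_⟩
  obtain ⟨a, b, hab⟩ := admissible_iff.1 hadm
  rw [hab]
  rw [run_append, hv] at hab
  rcases foldl_push_alternative hu hab with ⟨rfl, -⟩ | rfl
  · exact Or.inl ⟨b, rfl⟩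
  · exact Or.inr ⟨a, rfl⟩

/-- The contribution of a symbol to the height. -/
def Symbol.height : Symbol Γ Ω → ℤ
  | .neg _ => 1
  | .pos _ => -1
  | .loop _ => 0

lemma sum_height {w : List (Symbol Γ Ω)} {p q : List Γ} (h : run w = some (p, q)) :
    (w.map Symbol.height).sum = q.length - p.length := by
  induction w using List.reverseRecOn generalizing p q with
  | nil => simp at h; simp [h]
  | append_singleton w s ih =>
    rw [run_concat] at h
    rcases push_eq_some h with ⟨ω, rfl, hv⟩ | ⟨γ, q'', rfl, rfl, hv⟩ | ⟨γ, p'', rfl, rfl, rfl, hv⟩ |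
      ⟨γ, rfl, hv⟩ <;> simp [ih hv, Symbol.height] <;> ring

end Run

/-! ### Clean words and the three very pure monoids. -/

section Language

variable {Γ Ω : Type*} {ΞΩ : Ω → Finset Ω} {ΞΓ : Γ → Finset Ω}

/-- A word without excluded factors. -/
def FactorFree (ΞΩ : Ω → Finset Ω) (ΞΓ : Γ → Finset Ω) (w : List (Symbol Γ Ω)) : Prop :=
  ∀ f, ExcludedWord ΞΩ ΞΓ f → ¬ f <:+: w

lemma FactorFree.infix {u w : List (Symbol Γ Ω)} (hw : FactorFree ΞΩ ΞΓ w) (h : u <:+: w) :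
    FactorFree ΞΩ ΞΓ u :=
  fun f hf hu => hw f hf (hu.trans h)

lemma infix_append_cases {α : Type*} {l u v : List α} (h : l <:+: u ++ v) :
    l <:+: u ∨ l <:+: v ∨ ∃ l₁ l₂, l = l₁ ++ l₂ ∧ l₁ ≠ [] ∧ l₂ ≠ [] ∧ l₁ <:+ u ∧ l₂ <+: v := by
  obtain ⟨a, b, h⟩ := h
  rw [List.append_assoc] at h
  rcases List.append_eq_append_iff.1 h with ⟨c, rfl, hc⟩ | ⟨c, rfl, rfl⟩
  · rcases List.append_eq_append_iff.1 hc with ⟨d, rfl, rfl⟩ | ⟨d, rfl, rfl⟩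
    · exact Or.inl ⟨a, d, by simp⟩
    · by_cases hc' : c = []
      · subst hc'
        exact Or.inr (Or.inl ⟨[], b, by simp⟩)
      by_cases hd : d = []
      · subst hd
        exact Or.inl ⟨a, [], by simp⟩
      exact Or.inr (Or.inr ⟨c, d, rfl, hc', hd, ⟨a, rfl⟩, ⟨b, rfl⟩⟩)
  · exact Or.inr (Or.inl ⟨c, b, by simp⟩)

/-- A word that neither begins nor ends in the middle of a descent. -/
structure Clean (ΞΩ : Ω → Finset Ω) (ΞΓ : Γ → Finset Ω) (w : List (Symbol Γ Ω)) : Prop where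
  free : FactorFree ΞΩ ΞΓ w
  last (γ : Γ) : ¬ [.pos γ] <:+ w
  first (γ : Γ) : ¬ [.pos γ] <+: w
  second (ω : Ω) (γ : Γ) : ¬ [.loop ω, .pos γ] <+: w

lemma ExcludedWord.length_le {f : List (Symbol Γ Ω)} (hf : ExcludedWord ΞΩ ΞΓ f) :
    f.length ≤ 3 := by
  cases hf <;> simp

/-- However an excluded word is cut into two nonempty pieces, the left one ends with γ(+), or the
right one begins with γ(+) or with ωγ(+). This is what dictates the boundary conditions in `Clean`.
-/
lemma FactorFree.append {u v : List (Symbol Γ Ω)} (hu : FactorFree ΞΩ ΞΓ u)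
    (hv : FactorFree ΞΩ ΞΓ v) (h₁ : ∀ γ, ¬ [.pos γ] <:+ u) (h₂ : ∀ γ, ¬ [.pos γ] <+: v)
    (h₃ : ∀ ω γ, ¬ [.loop ω, .pos γ] <+: v) : FactorFree ΞΩ ΞΓ (u ++ v) := by
  intro f hf hfuv
  rcases infix_append_cases hfuv with h | h | ⟨l₁, l₂, rfl, hn₁, hn₂, hl₁, hl₂⟩
  · exact hu f hf h
  · exact hv f hf h
  have key : (∃ γ, [.pos γ] <:+ l₁) ∨ (∃ γ, [.pos γ] <+: l₂) ∨
      ∃ ω γ, [.loop ω, .pos γ] <+: l₂ := by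
    rcases l₁ with _ | ⟨a, _ | ⟨b, _ | ⟨c, l₁⟩⟩⟩
    · exact absurd rfl hn₁
    · rcases l₂ with _ | ⟨c, _ | ⟨d, _ | ⟨e, l₂⟩⟩⟩
      · exact absurd rfl hn₂
      all_goals simp only [List.cons_append, List.nil_append] at hf; cases hf <;> simp [← List.reverse_prefix]
    · rcases l₂ with _ | ⟨c, _ | ⟨d, l₂⟩⟩
      · exact absurd rfl hn₂
      all_goals simp only [List.cons_append, List.nil_append] at hf; cases hf <;> simp [← List.reverse_prefix]
    · rcases l₂ with _ | ⟨d, l₂⟩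
      · exact absurd rfl hn₂
      · exfalso
        have := hf.length_le
        simp at this
        omega
  rcases key with ⟨γ, h⟩ | ⟨γ, h⟩ | ⟨ω, γ, h⟩
  · exact h₁ γ (h.trans hl₁)
  · exact h₂ γ (h.trans hl₂)
  · exact h₃ ω γ (h.trans hl₂)

/-- A newly created excluded factor must be a suffix. It is phrased as a prefix of the reversed word
so that `simp` can compare letter by letter. -/
lemma factorFree_concat {w : List (Symbol Γ Ω)} {s : Symbol Γ Ω} (hw : FactorFree ΞΩ ΞΓ w)
    (h : ∀ f, ExcludedWord ΞΩ ΞΓ f → ¬ f.reverse <+: s :: w.reverse) :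
    FactorFree ΞΩ ΞΓ (w ++ [s]) := by
  intro f hf hfw
  rcases List.infix_concat_iff.1 hfw with h' | h'
  · refine h f hf ?_
    rw [← List.reverse_prefix] at h'
    simpa using h'
  · exact hw f hf h'

/-- Since ω follows a γ(+), the words that forbid a γ'(+) after ω cannot occur, and membership in
`ΞΩ ω` is the only condition left. -/
lemma FactorFree.descend {w : List (Symbol Γ Ω)} {γ γ' : Γ} {ω ω' : Ω}
    (hw : FactorFree ΞΩ ΞΓ (w ++ [.pos γ, .loop ω])) (h : ω' ∈ ΞΩ ω) :
    FactorFree ΞΩ ΞΓ (w ++ [.pos γ, .loop ω] ++ [.pos γ', .loop ω']) := by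
  have h₁ : FactorFree ΞΩ ΞΓ (w ++ [.pos γ, .loop ω] ++ [.pos γ']) := by
    refine factorFree_concat hw ?_
    rintro f hf
    cases hf <;> simp
  have h₂ := factorFree_concat (s := .loop ω') h₁ (by
    rintro f hf
    cases hf <;> simp
    rintro rfl rfl rfl
    contradiction)
  simpa using h₂

lemma factorFree_nil : FactorFree ΞΩ ΞΓ ([] : List (Symbol Γ Ω)) := by
  rintro f hf h
  rw [List.infix_nil] at h
  subst h
  cases hf

lemma FactorFree.peak {γ : Γ} {ω : Ω} (h : ω ∈ ΞΓ γ) :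
    FactorFree ΞΩ ΞΓ [.neg γ, .pos γ, .loop ω] := by
  have h₁ := factorFree_concat (ΞΩ := ΞΩ) (ΞΓ := ΞΓ) (s := .neg γ) factorFree_nil (by rintro f hf; cases hf <;> simp)
  have h₂ := factorFree_concat (s := .pos γ) h₁ (by rintro f hf; cases hf <;> simp)
  have h₃ := factorFree_concat (s := .loop ω) h₂ (by
    rintro f hf
    cases hf <;> simp
    rintro rfl rfl
    contradiction)
  simpa using h₃

lemma factorFree_singleton (s : Symbol Γ Ω) : FactorFree ΞΩ ΞΓ [s] := by
  intro f hf h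
  have := h.length_le
  cases hf <;> simp at this

lemma clean_nil : Clean ΞΩ ΞΓ ([] : List (Symbol Γ Ω)) where
  free := factorFree_nil
  last := by simp
  first := by simp
  second := by simp

lemma Clean.append {u v : List (Symbol Γ Ω)} (hu : Clean ΞΩ ΞΓ u) (hv : Clean ΞΩ ΞΓ v) :
    Clean ΞΩ ΞΓ (u ++ v) := by
  rcases List.eq_nil_or_concat v with rfl | ⟨v, t, rfl⟩
  · simpa using hu
  rw [List.concat_eq_append] at *
  refine ⟨hu.free.append hv.free hu.last hv.first hv.second, ?_, ?_, ?_⟩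
  · intro γ h
    refine hv.last γ ?_
    have := List.suffix_append u (v ++ [t])
    exact List.suffix_of_suffix_length_le h this (by simp)
  · intro γ h
    rcases u with _ | ⟨a, u⟩
    · exact hv.first γ (by simpa using h)
    · exact hu.first γ (by simpa using h)
  · intro ω γ h
    rcases u with _ | ⟨a, _ | ⟨b, u⟩⟩
    · exact hv.second ω γ (by simpa using h)
    · refine hv.first γ ?_
      simp at h
      exact h.2
    · exact hu.second ω γ (by simpa using h)

/-- The clean words whose normal form `(p, q)` has the property `R`. -/
def lang (ΞΩ : Ω → Finset Ω) (ΞΓ : Γ → Finset Ω) (R : List Γ → List Γ → Prop) :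
    Set (List (Symbol Γ Ω)) :=
  {w | Clean ΞΩ ΞΓ w ∧ ∃ p q, run w = some (p, q) ∧ R p q}


/-- The balanced clean words. -/
abbrev balanced (ΞΩ : Ω → Finset Ω) (ΞΓ : Γ → Finset Ω) : Set (List (Symbol Γ Ω)) :=
  lang ΞΩ ΞΓ fun p q => p = [] ∧ q = []

/-- The clean words in which every `γ(+)` is matched. -/
abbrev ascending (ΞΩ : Ω → Finset Ω) (ΞΓ : Γ → Finset Ω) : Set (List (Symbol Γ Ω)) :=
  lang ΞΩ ΞΓ fun p _ => p = []

/-- The clean words in which every `γ(-)` is matched. -/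
abbrev descending (ΞΩ : Ω → Finset Ω) (ΞΓ : Γ → Finset Ω) : Set (List (Symbol Γ Ω)) :=
  lang ΞΩ ΞΓ fun _ q => q = []

lemma Clean.left {u v : List (Symbol Γ Ω)} (huv : Clean ΞΩ ΞΓ (u ++ v))
    (hvu : ∀ γ, ¬ [.pos γ] <:+ u) : Clean ΞΩ ΞΓ u where
  free := huv.free.infix (List.prefix_append u v).isInfix
  last := hvu
  first γ h := huv.first γ (h.trans (List.prefix_append u v))
  second ω γ h := huv.second ω γ (h.trans (List.prefix_append u v))

/-- The conditions at the beginning of `u` are inherited from `u ++ v`, the condition at its end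
from `v ++ u`. -/
lemma Clean.pure {u v : List (Symbol Γ Ω)} (huv : Clean ΞΩ ΞΓ (u ++ v))
    (hvu : Clean ΞΩ ΞΓ (v ++ u)) : Clean ΞΩ ΞΓ u :=
  huv.left fun γ h => hvu.last γ (h.trans (List.suffix_append v u))

lemma run_append_of_nil_right {u v : List (Symbol Γ Ω)} {p p' q : List Γ}
    (hu : run u = some (p, [])) (hv : run v = some (p', q)) :
    run (u ++ v) = some (p' ++ p, q) := by
  rw [run_append, hu, foldl_push_of_nil_right hv]

lemma run_append_of_nil_left {u v : List (Symbol Γ Ω)} {p q q' : List Γ}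
    (hu : run u = some (p, q)) (hv : run v = some ([], q')) :
    run (u ++ v) = some (p, q' ++ q) := by
  rw [run_append, hu, foldl_push_of_nil_left hv]

lemma exists_run_left {u v : List (Symbol Γ Ω)} {p q : List Γ}
    (h : run (u ++ v) = some (p, q)) :
    ∃ p' q', run u = some (p', q') ∧ p'.length ≤ p.length := by
  rw [run_append] at h
  rcases hu : run u with _ | ⟨p', q'⟩
  · simp [hu, foldl_push_none] at h
  · rw [hu] at h
    exact ⟨p', q', rfl, length_le_of_foldl_push h⟩

lemma run_left_eq_nil {u v : List (Symbol Γ Ω)} {q : List Γ}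
    (h : run (u ++ v) = some ([], q)) : ∃ q', run u = some ([], q') := by
  obtain ⟨p', q', hu, hle⟩ := exists_run_left h
  obtain rfl : p' = [] := by simpa using hle
  exact ⟨q', hu⟩

/-- A γ(-) unmatched in `v` finds no partner to its left either, so it would survive in `u ++ v`. -/
lemma run_right_eq_nil {u v : List (Symbol Γ Ω)} {p : List Γ}
    (h : run (u ++ v) = some (p, [])) : ∃ p', run v = some (p', []) := by
  have hadm : Admissible v :=
    (admissible_iff.2 ⟨_, _, h⟩).infix (List.suffix_append u v).isInfix
  obtain ⟨p', q', hv⟩ := admissible_iff.1 hadm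
  cases q' with
  | nil => exact ⟨p', hv⟩
  | cons γ q' =>
    obtain ⟨t, u', rfl, ht, hu'⟩ := exists_match_of_run hv
    exfalso
    rw [← List.append_assoc, List.append_cons, run_append, run_concat] at h
    rcases hx : run (u ++ t) with _ | ⟨a, b⟩
    · simp [hx, foldl_push_none] at h
    · rw [hx, push_neg, foldl_push_of_nil_left hu'] at h
      simp at h

lemma veryPure_ascending : VeryPure (ascending ΞΩ ΞΓ) where
  nil := ⟨clean_nil, [], [], rfl, rfl⟩
  append := by
    rintro u v ⟨hu, _, q, hru, rfl⟩ ⟨hv, _, q', hrv, rfl⟩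
    exact ⟨hu.append hv, _, _, run_append_of_nil_left hru hrv, rfl⟩
  pure := by
    rintro u v ⟨huv, _, q, hruv, rfl⟩ ⟨hvu, -⟩
    obtain ⟨q', hu⟩ := run_left_eq_nil hruv
    exact ⟨huv.pure hvu, _, _, hu, rfl⟩

lemma veryPure_descending : VeryPure (descending ΞΩ ΞΓ) where
  nil := ⟨clean_nil, [], [], rfl, rfl⟩
  append := by
    rintro u v ⟨hu, p, _, hru, rfl⟩ ⟨hv, p', _, hrv, rfl⟩
    exact ⟨hu.append hv, _, _, run_append_of_nil_right hru hrv, rfl⟩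
  pure := by
    rintro u v ⟨huv, -⟩ ⟨hvu, p, _, hrvu, rfl⟩
    obtain ⟨p', hu⟩ := run_right_eq_nil hrvu
    exact ⟨huv.pure hvu, _, _, hu, rfl⟩

lemma mem_balanced_iff {w : List (Symbol Γ Ω)} :
    w ∈ balanced ΞΩ ΞΓ ↔ w ∈ ascending ΞΩ ΞΓ ∧ w ∈ descending ΞΩ ΞΓ := by
  constructor
  · rintro ⟨hw, p, q, hr, hp, hq⟩
    exact ⟨⟨hw, p, q, hr, hp⟩, ⟨hw, p, q, hr, hq⟩⟩
  · rintro ⟨⟨hw, p, q, hr, hp⟩, ⟨-, p', q', hr', hq⟩⟩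
    rw [hr] at hr'
    simp at hr'
    exact ⟨hw, p, q, hr, hp, by rw [hr'.2, hq]⟩

lemma veryPure_balanced : VeryPure (balanced ΞΩ ΞΓ) where
  nil := ⟨clean_nil, [], [], rfl, rfl, rfl⟩
  append hu hv := by
    rw [mem_balanced_iff] at *
    exact ⟨veryPure_ascending.append hu.1 hv.1, veryPure_descending.append hu.2 hv.2⟩
  pure hu hv := by
    rw [mem_balanced_iff] at *
    exact ⟨veryPure_ascending.pure hu.1 hv.1, veryPure_descending.pure hu.2 hv.2⟩

end Language

/-! ### Length series of sets of words. -/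

section WordSeries

variable {S : Type*}

lemma gf_eq_wordSeries_range {α : Type*} {ℓ : α → ℕ} {f : α → List S} (hf : Function.Injective f)
    (h : ∀ a, (f a).length = ℓ a) : gf ℓ = wordSeries (Set.range f) :=
  gf_eq_of_bijective (Set.rangeFactorization f)
    ⟨fun _ _ hab => hf (congrArg Subtype.val hab), Set.rangeFactorization_surjective⟩ h

lemma wordSeries_union [Finite S] {A B : Set (List S)} (h : Disjoint A B) :
    wordSeries (A ∪ B) = wordSeries A + wordSeries B := by
  classical
  have hA := finite_length_eq A
  have hB := finite_length_eq B
  rw [wordSeries, wordSeries, wordSeries, ← gf_sum]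
  symm
  refine gf_eq_of_bijective (Equiv.Set.union h).symm (Equiv.bijective _) ?_
  rintro (a | a) <;> simp

lemma wordSeries_nil : wordSeries ({[]} : Set (List S)) = 1 := by
  rw [wordSeries, gf_eq_of_bijective (ℓ' := fun _ : Unit => 0) (fun _ => ())
    ⟨fun a b _ => Subsingleton.elim _ _, fun _ => ⟨⟨[], rfl⟩, rfl⟩⟩, gf_const]
  · simp
  · rintro ⟨_, rfl⟩
    rfl

lemma constantCoeff_wordSeries {M : Set (List S)} (h : [] ∈ M) :
    PowerSeries.constantCoeff (wordSeries M) = 1 := by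
  have : Nat.card {w : M // w.1.length = 0} = 1 := by
    rw [Nat.card_eq_one_iff_unique]
    refine ⟨⟨?_⟩, ⟨⟨⟨[], h⟩, rfl⟩⟩⟩
    rintro ⟨⟨a, _⟩, ha⟩ ⟨⟨b, _⟩, hb⟩
    simp at ha hb
    simp [ha, hb]
  rw [← PowerSeries.coeff_zero_eq_constantCoeff_apply]
  simp only [wordSeries, gf, PowerSeries.coeff_mk, this, Nat.cast_one]

end WordSeries

/-! ### The building blocks of clean words and their series. -/

section Decomposition

variable {Γ Ω : Type*} {ΞΩ : Ω → Finset Ω} {ΞΓ : Γ → Finset Ω} {R : List Γ → List Γ → Prop}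

/-- The words `γ(-) u γ(+) ω` with `u` balanced. -/
def arches (ΞΩ : Ω → Finset Ω) (ΞΓ : Γ → Finset Ω) : Set (List (Symbol Γ Ω)) :=
  {c | FactorFree ΞΩ ΞΓ c ∧
    ∃ γ u ω, c = .neg γ :: u ++ [.pos γ, .loop ω] ∧ run u = some ([], [])}

/-- The words of `lang ΞΩ ΞΓ R` that end with a descent. -/
def closing (ΞΩ : Ω → Finset Ω) (ΞΓ : Γ → Finset Ω) (R : List Γ → List Γ → Prop) :
    Set (List (Symbol Γ Ω)) :=
  {w | w ∈ lang ΞΩ ΞΓ R ∧ ∃ t γ ω, w = t ++ [.pos γ, .loop ω]}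

/-- The last letter of a word that ends with a descent. -/
noncomputable def lastLoop (w : closing ΞΩ ΞΓ R) : Ω := w.2.2.choose_spec.choose_spec.choose

lemma exists_eq_lastLoop (w : closing ΞΩ ΞΓ R) :
    ∃ t γ, w.1 = t ++ [.pos γ, .loop (lastLoop w)] :=
  ⟨_, _, w.2.2.choose_spec.choose_spec.choose_spec⟩

lemma lastLoop_eq {t : List (Symbol Γ Ω)} {γ : Γ} {ω : Ω}
    (h : t ++ [.pos γ, .loop ω] ∈ closing ΞΩ ΞΓ R) : lastLoop ⟨_, h⟩ = ω := by
  obtain ⟨t', γ', h'⟩ := exists_eq_lastLoop ⟨_, h⟩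
  have := (List.append_inj' h' rfl).2
  simp at this
  exact this.2.symm

lemma concat_loop_mem {w : List (Symbol Γ Ω)} (hw : w ∈ lang ΞΩ ΞΓ R) (ω : Ω) :
    w ++ [.loop ω] ∈ lang ΞΩ ΞΓ R := by
  obtain ⟨hw, p, q, hr, hR⟩ := hw
  refine ⟨hw.append ⟨factorFree_singleton _, ?_, ?_, ?_⟩, p, q, by simp [run_concat, hr], hR⟩
  · intro γ h; simp [← List.reverse_prefix] at h
  · simp
  · simp

lemma mem_of_concat_loop_mem {w : List (Symbol Γ Ω)} {ω : Ω}
    (hw : w ++ [.loop ω] ∈ lang ΞΩ ΞΓ R) (h : ∀ γ, ¬ [.pos γ] <:+ w) : w ∈ lang ΞΩ ΞΓ R := by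
  obtain ⟨hw, p, q, hr, hR⟩ := hw
  exact ⟨hw.left h, p, q, by simpa [run_concat] using hr, hR⟩

lemma arch_clean {c : List (Symbol Γ Ω)} (hc : c ∈ arches ΞΩ ΞΓ) :
    Clean ΞΩ ΞΓ c ∧ run c = some ([], []) := by
  obtain ⟨hf, γ, u, ω, rfl, hu⟩ := hc
  refine ⟨⟨hf, ?_, ?_, ?_⟩, ?_⟩
  · intro γ h; simp [← List.reverse_prefix] at h
  · simp
  · simp
  · have : (.neg γ :: u ++ [.pos γ, .loop ω] : List (Symbol Γ Ω)) =
      [.neg γ] ++ u ++ [.pos γ] ++ [.loop ω] := by simp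
    rw [this, run_concat, run_concat, run_append_of_nil_left (p := []) (q := [γ]) rfl hu]
    simp

lemma append_arch_mem {w c : List (Symbol Γ Ω)} (hw : w ∈ lang ΞΩ ΞΓ R)
    (hc : c ∈ arches ΞΩ ΞΓ) : w ++ c ∈ lang ΞΩ ΞΓ R := by
  obtain ⟨hw, p, q, hr, hR⟩ := hw
  obtain ⟨hc, hrc⟩ := arch_clean hc
  exact ⟨hw.append hc, p, q, run_append_of_nil_left hr hrc, hR⟩

/-- The final γ(+) is matched, and the arch begins at its partner. The remaining word is clean
because γ(+) directly before that γ(-) is excluded. -/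
lemma exists_arch {t : List (Symbol Γ Ω)} {γ γ' : Γ} {ω : Ω} {p q : List Γ}
    (hw : t ++ [.pos γ, .loop ω] ∈ lang ΞΩ ΞΓ R) (ht : run t = some (p, γ' :: q)) :
    ∃ w ∈ lang ΞΩ ΞΓ R, ∃ c ∈ arches ΞΩ ΞΓ, w ++ c = t ++ [.pos γ, .loop ω] := by
  obtain ⟨hw, p', q', hr, hR⟩ := hw
  rw [List.append_cons, run_concat, run_concat, ht] at hr
  obtain rfl : γ' = γ := by
    by_contra h
    simp [push, h] at hr
  simp at hr
  obtain ⟨rfl, rfl⟩ := hr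
  obtain ⟨t, u, rfl, ht, hu⟩ := exists_match_of_run ht
  have e : t ++ .neg γ' :: u ++ [.pos γ', .loop ω] = t ++ (.neg γ' :: u ++ [.pos γ', .loop ω]) := by
    simp
  refine ⟨t, ⟨(e ▸ hw).left ?_, _, _, ht, hR⟩, _,
    ⟨hw.free.infix (e ▸ (List.suffix_append _ _).isInfix), γ', u, ω, rfl, hu⟩, e.symm⟩
  rintro a ⟨t', rfl⟩
  exact hw.free _ (.pos_neg a γ') ⟨t', u ++ [.pos γ', .loop ω], by simp⟩

/-- As no γ(-) is waiting, neither the last letter of `t` nor the one before a final ω is a γ(-).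
The excluded words then force an earlier γ'(+)ω', unless `t` is too short. -/
lemma exists_descent {t : List (Symbol Γ Ω)} {γ : Γ} {p : List Γ}
    (hf : FactorFree ΞΩ ΞΓ (t ++ [.pos γ])) (hr : run t = some (p, [])) (h₀ : t ≠ [])
    (h₁ : ∀ ω, t ≠ [.loop ω]) : ∃ t' γ' ω', t = t' ++ [.pos γ', .loop ω'] := by
  rcases List.eq_nil_or_concat t with rfl | ⟨t, s, rfl⟩
  · exact absurd rfl h₀
  rw [List.concat_eq_append] at *
  cases s with
  | pos a => exact absurd ⟨t, [], by simp⟩ (hf _ (.pos_pos a γ))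
  | neg a =>
    rw [run_concat] at hr
    rcases hx : run t with _ | ⟨p', q'⟩ <;> simp [hx] at hr
  | loop ω =>
    rcases List.eq_nil_or_concat t with rfl | ⟨t, s, rfl⟩
    · exact absurd rfl (h₁ ω)
    rw [List.concat_eq_append] at *
    cases s with
    | pos a => exact ⟨t, a, ω, by simp⟩
    | neg a =>
      rw [run_concat, run_concat] at hr
      rcases hx : run t with _ | ⟨p', q'⟩ <;> simp [hx] at hr
    | loop a => exact absurd ⟨t, [], by simp⟩ (hf _ (.loop_loop_pos a ω γ))

/-- The arch is recovered from the product, since it begins at the partner of the last γ(+)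
(`match_unique`). -/
lemma append_arch_injective : Function.Injective
    (fun x : lang ΞΩ ΞΓ R × arches ΞΩ ΞΓ => x.1.1 ++ x.2.1) := by
  rintro ⟨⟨w, hw⟩, ⟨c, hc⟩⟩ ⟨⟨w', hw'⟩, ⟨c', hc'⟩⟩ h
  replace h : w ++ c = w' ++ c' := h
  obtain ⟨_, γ, u, ω, rfl, hu⟩ := id hc
  obtain ⟨_, γ', u', ω', rfl, hu'⟩ := id hc'
  rw [← List.append_assoc, ← List.append_assoc] at h
  obtain ⟨h₁, h₂⟩ := List.append_inj' h rfl
  obtain ⟨rfl, rfl, rfl⟩ := match_unique hu hu' h₁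
  simp at h₂
  subst h₂
  rfl

/-- The words `w ω` with `w` in `lang ΞΩ ΞΓ R`. -/
def loopEnd (ΞΩ : Ω → Finset Ω) (ΞΓ : Γ → Finset Ω) (R : List Γ → List Γ → Prop) :
    Set (List (Symbol Γ Ω)) :=
  Set.range fun x : lang ΞΩ ΞΓ R × Ω => x.1.1 ++ [.loop x.2]

/-- The words `w γ(-)` with `w` in `lang ΞΩ ΞΓ R`. -/
def negEnd (ΞΩ : Ω → Finset Ω) (ΞΓ : Γ → Finset Ω) (R : List Γ → List Γ → Prop) :
    Set (List (Symbol Γ Ω)) :=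
  Set.range fun x : lang ΞΩ ΞΓ R × Γ => x.1.1 ++ [.neg x.2]

/-- The words `w c` with `w` in `lang ΞΩ ΞΓ R` and an arch `c`. -/
def archEnd (ΞΩ : Ω → Finset Ω) (ΞΓ : Γ → Finset Ω) (R : List Γ → List Γ → Prop) :
    Set (List (Symbol Γ Ω)) :=
  Set.range fun x : lang ΞΩ ΞΓ R × arches ΞΩ ΞΓ => x.1.1 ++ x.2.1

/-- The continuations of the descents of the words that end with a descent. -/
abbrev Descent (ΞΩ : Ω → Finset Ω) (ΞΓ : Γ → Finset Ω) (R : List Γ → List Γ → Prop) : Type _ :=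
  Σ w : closing ΞΩ ΞΓ R, Γ × {ω // ω ∈ ΞΩ (lastLoop w)}

/-- The words `w γ(+) ω` with an unmatched `γ(+)`, where `w` ends with a descent. -/
def descentEnd (ΞΩ : Ω → Finset Ω) (ΞΓ : Γ → Finset Ω) (R : List Γ → List Γ → Prop) :
    Set (List (Symbol Γ Ω)) :=
  Set.range fun x : Descent ΞΩ ΞΓ R => x.1.1 ++ [.pos x.2.1, .loop x.2.2.1]

/-- The prefix `f` serves two uses: it is empty for an unmatched continuation of a descent and is
γ(-) for an arch. -/
lemma descent_injective (f : Γ → List (Symbol Γ Ω)) (hf : ∀ γ γ', (f γ).length = (f γ').length) :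
    Function.Injective fun x : Descent ΞΩ ΞΓ R =>
      f x.2.1 ++ (x.1.1 ++ [.pos x.2.1, .loop x.2.2.1]) := by
  rintro ⟨w, γ, ω, hω⟩ ⟨w', γ', ω', hω'⟩ h
  dsimp only at h
  obtain ⟨-, h⟩ := List.append_inj h (hf _ _)
  obtain ⟨h₁, h₂⟩ := List.append_inj' h rfl
  obtain rfl : w = w' := Subtype.ext h₁
  simp at h₂
  obtain ⟨rfl, rfl⟩ := h₂
  rfl

section Series

variable [Finite Γ] [Finite Ω]

instance : Finite (Symbol Γ Ω) := by
  refine Finite.of_injective (β := Γ ⊕ Γ ⊕ Ω) (fun s => match s with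
    | .neg γ => .inl γ
    | .pos γ => .inr (.inl γ)
    | .loop ω => .inr (.inr ω)) ?_
  rintro (γ | γ | ω) (γ' | γ' | ω') h <;> simp_all

lemma wordSeries_loopEnd : wordSeries (loopEnd ΞΩ ΞΓ R) =
    wordSeries (lang ΞΩ ΞΓ R) * ((Nat.card Ω : PowerSeries ℚ) * PowerSeries.X) := by
  have := finite_length_eq (lang ΞΩ ΞΓ R)
  rw [loopEnd, ← gf_eq_wordSeries_range (ℓ := fun x : lang ΞΩ ΞΓ R × Ω => x.1.1.length + 1)]
  · rw [gf_prod (fun w : lang ΞΩ ΞΓ R => w.1.length) (fun _ : Ω => 1), gf_const, pow_one]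
    rfl
  · rintro ⟨⟨w, hw⟩, ω⟩ ⟨⟨w', hw'⟩, ω'⟩ h
    obtain ⟨h₁, h₂⟩ := List.append_inj' h rfl
    simp_all
  · simp

lemma wordSeries_negEnd : wordSeries (negEnd ΞΩ ΞΓ R) =
    wordSeries (lang ΞΩ ΞΓ R) * ((Nat.card Γ : PowerSeries ℚ) * PowerSeries.X) := by
  have := finite_length_eq (lang ΞΩ ΞΓ R)
  rw [negEnd, ← gf_eq_wordSeries_range (ℓ := fun x : lang ΞΩ ΞΓ R × Γ => x.1.1.length + 1)]
  · rw [gf_prod (fun w : lang ΞΩ ΞΓ R => w.1.length) (fun _ : Γ => 1), gf_const, pow_one]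
    rfl
  · rintro ⟨⟨w, hw⟩, ω⟩ ⟨⟨w', hw'⟩, ω'⟩ h
    obtain ⟨h₁, h₂⟩ := List.append_inj' h rfl
    simp_all
  · simp

lemma wordSeries_archEnd : wordSeries (archEnd ΞΩ ΞΓ R) =
    wordSeries (lang ΞΩ ΞΓ R) * wordSeries (arches ΞΩ ΞΓ) := by
  have := finite_length_eq (lang ΞΩ ΞΓ R)
  have := finite_length_eq (arches ΞΩ ΞΓ)
  rw [archEnd, ← gf_eq_wordSeries_range (ℓ := fun x : lang ΞΩ ΞΓ R × arches ΞΩ ΞΓ =>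
    x.1.1.length + x.2.1.length) append_arch_injective (by simp)]
  exact gf_prod (fun w : lang ΞΩ ΞΓ R => w.1.length) (fun w : arches ΞΩ ΞΓ => w.1.length)

/-- Whatever the last letter of the closing word, there are `N` choices of γ and `K` of ω, so the
sum over closing words factors. -/
lemma wordSeries_descents {K : ℕ} (hΞΩ : ∀ ω, (ΞΩ ω).card = K) (f : Γ → List (Symbol Γ Ω)) {k : ℕ}
    (hf : ∀ γ, (f γ).length = k) :
    wordSeries (Set.range fun x : Descent ΞΩ ΞΓ R =>
      f x.2.1 ++ (x.1.1 ++ [.pos x.2.1, .loop x.2.2.1])) =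
    wordSeries (closing ΞΩ ΞΓ R) *
      (((Nat.card Γ * K : ℕ) : PowerSeries ℚ) * PowerSeries.X ^ (k + 2)) := by
  have := finite_length_eq (closing ΞΩ ΞΓ R)
  rw [← gf_eq_wordSeries_range
    (ℓ := fun x : Descent ΞΩ ΞΓ R => x.1.1.length + (k + 2))
    (descent_injective f (by simp [hf]))]
  · exact gf_sigma (fun w : closing ΞΩ ΞΓ R => w.1.length)
      (by intro a; rw [Nat.card_prod]; simp [hΞΩ]) _
  · intro a
    simp [hf]; ring

lemma wordSeries_descentEnd {K : ℕ} (hΞΩ : ∀ ω, (ΞΩ ω).card = K) :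
    wordSeries (descentEnd ΞΩ ΞΓ R) = wordSeries (closing ΞΩ ΞΓ R) *
      (((Nat.card Γ * K : ℕ) : PowerSeries ℚ) * PowerSeries.X ^ 2) :=
  wordSeries_descents hΞΩ (fun _ => []) (k := 0) (by simp)

end Series

end Decomposition

/-! ### Unambiguous grammars and the equations for the series. -/

section Equations

variable {Γ Ω : Type*} {ΞΩ : Ω → Finset Ω} {ΞΓ : Γ → Finset Ω} {R : List Γ → List Γ → Prop}

lemma closing_subset : closing ΞΩ ΞΓ R ⊆ lang ΞΩ ΞΓ R := fun _ h => h.1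

lemma archEnd_subset_closing : archEnd ΞΩ ΞΓ R ⊆ closing ΞΩ ΞΓ R := by
  rintro _ ⟨⟨⟨w, hw⟩, ⟨c, hc⟩⟩, rfl⟩
  refine ⟨append_arch_mem hw hc, ?_⟩
  obtain ⟨-, γ, u, ω, rfl, hu⟩ := hc
  exact ⟨w ++ .neg γ :: u, γ, ω, by simp⟩

lemma loopEnd_subset : loopEnd ΞΩ ΞΓ R ⊆ lang ΞΩ ΞΓ R := by
  rintro _ ⟨⟨⟨w, hw⟩, ω⟩, rfl⟩
  exact concat_loop_mem hw ω

/-- The last letter decides. A final ω closes a descent exactly if a γ(+) precedes it; otherwise it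
can be stripped without losing cleanness. -/
lemma lang_cases {w : List (Symbol Γ Ω)} (hw : w ∈ lang ΞΩ ΞΓ R) :
    w = [] ∨ w ∈ loopEnd ΞΩ ΞΓ R ∨ (∃ t γ, w = t ++ [.neg γ]) ∨ w ∈ closing ΞΩ ΞΓ R := by
  rcases List.eq_nil_or_concat w with rfl | ⟨w, s, rfl⟩
  · exact Or.inl rfl
  rw [List.concat_eq_append] at *
  cases s with
  | neg γ => exact Or.inr (Or.inr (Or.inl ⟨w, γ, rfl⟩))
  | pos γ => exact absurd (List.suffix_append _ _) (hw.1.last γ)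
  | loop ω =>
    by_cases h : ∃ γ, [.pos γ] <:+ w
    · obtain ⟨γ, t, rfl⟩ := h
      exact Or.inr (Or.inr (Or.inr ⟨hw, t, γ, ω, by simp⟩))
    · push Not at h
      exact Or.inr (Or.inl ⟨(⟨w, mem_of_concat_loop_mem hw h⟩, ω), rfl⟩)

lemma disjoint_nil_loopEnd : Disjoint {[]} (loopEnd ΞΩ ΞΓ R) := by
  rw [Set.disjoint_singleton_left]
  rintro ⟨x, h⟩
  simp at h

lemma disjoint_nil_closing : Disjoint {[]} (closing ΞΩ ΞΓ R) := by
  rw [Set.disjoint_singleton_left]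
  rintro ⟨-, t, γ, ω, h⟩
  simp at h

lemma disjoint_loopEnd_closing : Disjoint (loopEnd ΞΩ ΞΓ R) (closing ΞΩ ΞΓ R) := by
  rw [Set.disjoint_left]
  rintro _ ⟨⟨⟨w, hw⟩, ω⟩, rfl⟩ ⟨-, t, γ, ω', h⟩
  rw [List.append_cons] at h
  obtain ⟨h₁, -⟩ := List.append_inj' h rfl
  dsimp only at h₁
  subst h₁
  exact hw.1.last γ (List.suffix_append _ _)

lemma mem_archEnd {t : List (Symbol Γ Ω)} {γ γ' : Γ} {ω : Ω} {p q : List Γ}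
    (hw : t ++ [.pos γ, .loop ω] ∈ lang ΞΩ ΞΓ R) (ht : run t = some (p, γ' :: q)) :
    t ++ [.pos γ, .loop ω] ∈ archEnd ΞΩ ΞΓ R := by
  obtain ⟨w, hw, c, hc, h⟩ := exists_arch hw ht
  exact ⟨(⟨w, hw⟩, ⟨c, hc⟩), h⟩

lemma run_descent {t : List (Symbol Γ Ω)} {γ : Γ} {ω : Ω} {p : List Γ}
    (ht : run t = some (p, [])) : run (t ++ [.pos γ, .loop ω]) = some (γ :: p, []) := by
  rw [List.append_cons, run_concat, run_concat, ht]
  simp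

lemma exists_run_of_mem {u v : List (Symbol Γ Ω)} (h : u ++ v ∈ lang ΞΩ ΞΓ R) :
    ∃ p q, run u = some (p, q) := by
  obtain ⟨-, p, q, h, -⟩ := h
  obtain ⟨p', q', h', -⟩ := exists_run_left h
  exact ⟨p', q', h'⟩

/-- If the final γ(+) were unmatched, it would appear in the first part of the normal form, which
`hR` makes empty. -/
lemma closing_eq_archEnd (hR : ∀ p q, R p q → p = []) : closing ΞΩ ΞΓ R = archEnd ΞΩ ΞΓ R := by
  refine Set.Subset.antisymm ?_ archEnd_subset_closing
  rintro _ ⟨hw, t, γ, ω, rfl⟩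
  obtain ⟨p, q, ht⟩ := exists_run_of_mem hw
  cases q with
  | cons γ' q => exact mem_archEnd hw ht
  | nil =>
    obtain ⟨-, p', q', hr, hR'⟩ := hw
    rw [run_descent ht] at hr
    simp at hr
    rw [hR _ _ hR'] at hr
    simp at hr

lemma lang_eq_of_nil_right (h₀ : R [] []) (hR : ∀ p q, R p q → q = []) :
    lang ΞΩ ΞΓ R = {[]} ∪ (loopEnd ΞΩ ΞΓ R ∪ closing ΞΩ ΞΓ R) := by
  refine Set.Subset.antisymm ?_ ?_
  · intro w hw
    rcases lang_cases hw with h | h | ⟨t, γ, rfl⟩ | h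
    · exact Or.inl h
    · exact Or.inr (Or.inl h)
    · obtain ⟨-, p, q, hr, hpq⟩ := hw
      rw [hR _ _ hpq, run_concat] at hr
      rcases hx : run t with _ | ⟨p', q'⟩ <;> simp [hx] at hr
    · exact Or.inr (Or.inr h)
  · refine Set.union_subset ?_ (Set.union_subset loopEnd_subset closing_subset)
    rintro _ rfl
    exact ⟨clean_nil, [], [], rfl, h₀⟩

lemma ascending_eq : ascending ΞΩ ΞΓ =
    ({[]} ∪ (loopEnd ΞΩ ΞΓ (fun p _ => p = []) ∪ archEnd ΞΩ ΞΓ (fun p _ => p = []))) ∪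
      negEnd ΞΩ ΞΓ (fun p _ => p = []) := by
  refine Set.Subset.antisymm ?_ ?_
  · intro w hw
    rcases lang_cases hw with h | h | ⟨t, γ, rfl⟩ | h
    · exact Or.inl (Or.inl h)
    · exact Or.inl (Or.inr (Or.inl h))
    · refine Or.inr ⟨(⟨t, ?_⟩, γ), rfl⟩
      obtain ⟨hw, _, q, hr, rfl⟩ := hw
      obtain ⟨q', ht⟩ := run_left_eq_nil hr
      refine ⟨hw.left ?_, _, _, ht, rfl⟩
      rintro a ⟨t', rfl⟩
      exact hw.free _ (.pos_neg a γ) ⟨t', [], by simp⟩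
    · exact Or.inl (Or.inr (Or.inr (closing_eq_archEnd (fun _ _ h => h) ▸ h)))
  · refine Set.union_subset (Set.union_subset ?_ (Set.union_subset loopEnd_subset
      (archEnd_subset_closing.trans closing_subset))) ?_
    · rintro _ rfl
      exact ⟨clean_nil, [], [], rfl, rfl⟩
    · rintro _ ⟨⟨⟨w, hw⟩, γ⟩, rfl⟩
      refine veryPure_ascending.append hw
        ⟨⟨factorFree_singleton _, ?_, ?_, ?_⟩, [], [γ], rfl, rfl⟩ <;>
        simp [← List.reverse_prefix]

lemma descentEnd_subset_closing :
    descentEnd ΞΩ ΞΓ (fun _ q => q = []) ⊆ closing ΞΩ ΞΓ (fun _ q => q = []) := by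
  rintro _ ⟨⟨w, γ, ω, hω⟩, rfl⟩
  obtain ⟨t, γ', hw⟩ := exists_eq_lastLoop w
  obtain ⟨⟨hwc, p, _, hr, rfl⟩, -⟩ := w.2
  refine ⟨⟨⟨?_, ?_, ?_, ?_⟩, _, _, run_descent hr, rfl⟩, w.1, γ, ω, rfl⟩
  · have := hwc.free
    change FactorFree ΞΩ ΞΓ (w.1 ++ [.pos γ, .loop ω])
    rw [hw] at this ⊢
    exact this.descend hω
  · intro a h; simp [← List.reverse_prefix] at h
  · intro a h
    -- The closing word `w` has at least two letters, so the conditions at the beginning concern `w`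
    -- alone.
    exact hwc.first a (List.prefix_of_prefix_length_le h (List.prefix_append _ _) (by simp [hw]))
  · intro ω' a h
    exact hwc.second ω' a (List.prefix_of_prefix_length_le h (List.prefix_append _ _) (by simp [hw]))

/-- A matched last γ(+) ends an arch. An unmatched one cannot start the word, by cleanness, so it
continues an earlier descent. -/
lemma closing_eq_union : closing ΞΩ ΞΓ (fun _ q => q = []) =
    descentEnd ΞΩ ΞΓ (fun _ q => q = []) ∪ archEnd ΞΩ ΞΓ (fun _ q => q = []) := by
  refine Set.Subset.antisymm ?_ (Set.union_subset descentEnd_subset_closing archEnd_subset_closing)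
  rintro _ ⟨hw, t, γ, ω, rfl⟩
  obtain ⟨p, q, ht⟩ := exists_run_of_mem hw
  cases q with
  | cons γ' q => exact Or.inr (mem_archEnd hw ht)
  | nil =>
    left
    obtain ⟨hwc, -⟩ := hw
    have hf : FactorFree ΞΩ ΞΓ (t ++ [.pos γ]) := hwc.free.infix ⟨[], [.loop ω], by simp⟩
    obtain ⟨t', γ', ω', rfl⟩ := exists_descent hf ht (by rintro rfl; exact hwc.first γ (by simp))
      (by rintro ω' rfl; exact hwc.second ω' γ (by simp))
    have hmem : t' ++ [.pos γ', .loop ω'] ∈ closing ΞΩ ΞΓ (fun _ q => q = []) := by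
      refine ⟨⟨hwc.left ?_, _, _, ht, rfl⟩, t', γ', ω', rfl⟩
      intro a h; simp [← List.reverse_prefix] at h
    refine ⟨⟨⟨_, hmem⟩, γ, ω, ?_⟩, rfl⟩
    rw [lastLoop_eq]
    by_contra h
    exact hwc.free _ (.loop_pos_loop γ ω' ω h) ⟨t' ++ [.pos γ'], [], by simp⟩

/-- The normal form before the last γ(+) tells the cases apart: it has a waiting γ(-) exactly in the
case of an arch. -/
lemma disjoint_descentEnd_archEnd : Disjoint (descentEnd ΞΩ ΞΓ (fun _ q => q = []))
    (archEnd ΞΩ ΞΓ (fun _ q => q = [])) := by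
  rw [Set.disjoint_left]
  rintro _ ⟨⟨w, γ, ω, hω⟩, rfl⟩ ⟨⟨⟨w', hw'⟩, ⟨c, hc⟩⟩, h⟩
  obtain ⟨⟨-, p, _, hr, rfl⟩, -⟩ := w.2
  replace h : w' ++ c = w.1 ++ [.pos γ, .loop ω] := h
  obtain ⟨_, γ', u, ω', rfl, hu⟩ := id hc
  rw [← List.append_assoc] at h
  obtain ⟨h₁, -⟩ := List.append_inj' h rfl
  rw [← h₁] at hr
  rw [List.append_cons, run_append, run_concat] at hr
  rcases hx : run w' with _ | ⟨a, b⟩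
  · simp [hx, foldl_push_none] at hr
  · rw [hx, push_neg, foldl_push_of_nil_left hu] at hr
    simp at hr

/-- The words `γ(-) γ(+) ω`, `ω ∈ ΞΓ γ`. -/
def peaks (ΞΓ : Γ → Finset Ω) : Set (List (Symbol Γ Ω)) :=
  Set.range fun x : Σ γ, {ω // ω ∈ ΞΓ γ} => [.neg x.1, .pos x.1, .loop x.2.1]

/-- The words `γ(-) u γ(+) ω` in `arches ΞΩ ΞΓ` with `u` not empty. -/
def highArches (ΞΩ : Ω → Finset Ω) (ΞΓ : Γ → Finset Ω) : Set (List (Symbol Γ Ω)) :=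
  Set.range fun x : Descent ΞΩ ΞΓ (fun p q => p = [] ∧ q = []) =>
    [.neg x.2.1] ++ (x.1.1 ++ [.pos x.2.1, .loop x.2.2.1])

lemma disjoint_peaks_highArches : Disjoint (peaks ΞΓ) (highArches ΞΩ ΞΓ) := by
  rw [Set.disjoint_left]
  rintro _ ⟨⟨γ, ω, hω⟩, rfl⟩ ⟨⟨w, γ', ω', hω'⟩, h⟩
  obtain ⟨t, a, hw⟩ := exists_eq_lastLoop w
  have := congrArg List.length h
  simp [hw] at this

/-- If the inside `u` is empty, the final ω is restricted by `ΞΓ`. If not, `u` itself ends with a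
descent, and the final ω is restricted by `ΞΩ` at the last letter of `u`. -/
lemma arches_eq : arches ΞΩ ΞΓ = peaks ΞΓ ∪ highArches ΞΩ ΞΓ := by
  refine Set.Subset.antisymm ?_ (Set.union_subset ?_ ?_)
  · rintro _ ⟨hf, γ, u, ω, rfl, hu⟩
    rcases eq_or_ne u [] with rfl | hne
    · refine Or.inl ⟨⟨γ, ω, ?_⟩, rfl⟩
      by_contra h
      exact hf _ (.neg_pos_loop γ ω h) ⟨[], [], by simp⟩
    · right
      have hfu : FactorFree ΞΩ ΞΓ u := hf.infix ⟨[.neg γ], [.pos γ, .loop ω], by simp⟩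
      have hfu' : FactorFree ΞΩ ΞΓ (u ++ [.pos γ]) := hf.infix ⟨[.neg γ], [.loop ω], by simp⟩
      obtain ⟨t, γ', ω', rfl⟩ := exists_descent hfu' hu hne (by
        rintro ω' rfl
        exact hf _ (.neg_loop_pos γ ω') ⟨[], [.loop ω], by simp⟩)
      have hmem : t ++ [.pos γ', .loop ω'] ∈ closing ΞΩ ΞΓ (fun p q => p = [] ∧ q = []) := by
        refine ⟨⟨⟨hfu, ?_, ?_, ?_⟩, _, _, hu, rfl, rfl⟩, t, γ', ω', rfl⟩
        · intro a h; simp [← List.reverse_prefix] at h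
        -- A balanced word cannot begin with γ(+) or ωγ(+), since that γ(+) would be unmatched.
        · rintro a ⟨v, h⟩
          rw [← h] at hu
          obtain ⟨q, hq⟩ := run_left_eq_nil hu
          simp [run, push] at hq
        · rintro b a ⟨v, h⟩
          rw [← h] at hu
          obtain ⟨q, hq⟩ := run_left_eq_nil hu
          simp [run, push] at hq
      refine ⟨⟨⟨_, hmem⟩, γ, ω, ?_⟩, by simp⟩
      rw [lastLoop_eq]
      by_contra h
      exact hf _ (.loop_pos_loop γ ω' ω h) ⟨.neg γ :: t ++ [.pos γ'], [], by simp⟩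
  · rintro _ ⟨⟨γ, ω, hω⟩, rfl⟩
    exact ⟨.peak hω, γ, [], ω, rfl, rfl⟩
  · rintro _ ⟨⟨w, γ, ω, hω⟩, rfl⟩
    obtain ⟨t, γ', hw⟩ := exists_eq_lastLoop w
    obtain ⟨⟨hwc, p, q, hr, rfl, rfl⟩, -⟩ := w.2
    refine ⟨?_, γ, w.1, ω, by simp, hr⟩
    have h₁ : FactorFree ΞΩ ΞΓ ([.neg γ] ++ w.1) :=
      (factorFree_singleton _).append hwc.free (by simp [← List.reverse_prefix]) hwc.first
        hwc.second
    rw [hw, ← List.append_assoc] at h₁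
    have h₂ := h₁.descend (γ' := γ) hω
    dsimp only
    rw [hw]
    simpa using h₂

section Series

variable [Finite Γ] [Finite Ω]

lemma wordSeries_balanced : wordSeries (balanced ΞΩ ΞΓ) =
    1 + wordSeries (balanced ΞΩ ΞΓ) * ((Nat.card Ω : PowerSeries ℚ) * PowerSeries.X) +
      wordSeries (balanced ΞΩ ΞΓ) * wordSeries (arches ΞΩ ΞΓ) := by
  conv_lhs => rw [balanced, lang_eq_of_nil_right ⟨rfl, rfl⟩ fun _ _ h => h.2]
  rw [wordSeries_union (Set.disjoint_union_right.2 ⟨disjoint_nil_loopEnd, disjoint_nil_closing⟩),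
    wordSeries_union disjoint_loopEnd_closing, wordSeries_nil, wordSeries_loopEnd,
    closing_eq_archEnd fun _ _ h => h.1, wordSeries_archEnd, add_assoc]

lemma wordSeries_ascending : wordSeries (ascending ΞΩ ΞΓ) =
    1 + wordSeries (ascending ΞΩ ΞΓ) * ((Nat.card Ω : PowerSeries ℚ) * PowerSeries.X) +
      wordSeries (ascending ΞΩ ΞΓ) * wordSeries (arches ΞΩ ΞΓ) +
      wordSeries (ascending ΞΩ ΞΓ) * ((Nat.card Γ : PowerSeries ℚ) * PowerSeries.X) := by
  have h : Disjoint ({[]} ∪ (loopEnd ΞΩ ΞΓ (fun p _ => p = []) ∪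
      archEnd ΞΩ ΞΓ (fun p _ => p = []))) (negEnd ΞΩ ΞΓ (fun p _ => p = [])) := by
    rw [Set.disjoint_right]
    rintro _ ⟨⟨⟨w, hw⟩, γ⟩, rfl⟩ (h | ⟨⟨⟨w, hw⟩, ω⟩, h⟩ | h)
    · simp at h
    · have := (List.append_inj' h rfl).2
      simp at this
    · obtain ⟨-, t, γ', ω, h⟩ := archEnd_subset_closing h
      rw [List.append_cons] at h
      have := (List.append_inj' h rfl).2
      simp at this
  conv_lhs => rw [ascending_eq]
  rw [wordSeries_union h,
    wordSeries_union (Set.disjoint_union_right.2 ⟨disjoint_nil_loopEnd,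
      disjoint_nil_closing.mono_right archEnd_subset_closing⟩),
    wordSeries_union (disjoint_loopEnd_closing.mono_right archEnd_subset_closing), wordSeries_nil,
    wordSeries_loopEnd, wordSeries_archEnd, wordSeries_negEnd, ← add_assoc]

lemma wordSeries_descending : wordSeries (descending ΞΩ ΞΓ) =
    1 + wordSeries (descending ΞΩ ΞΓ) * ((Nat.card Ω : PowerSeries ℚ) * PowerSeries.X) +
      wordSeries (closing ΞΩ ΞΓ fun _ q => q = []) := by
  conv_lhs => rw [descending, lang_eq_of_nil_right (R := fun _ q => q = []) rfl fun _ _ h => h]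
  rw [wordSeries_union (Set.disjoint_union_right.2 ⟨disjoint_nil_loopEnd, disjoint_nil_closing⟩),
    wordSeries_union disjoint_loopEnd_closing, wordSeries_nil, wordSeries_loopEnd, add_assoc]

lemma wordSeries_closing {K : ℕ} (hΞΩ : ∀ ω, (ΞΩ ω).card = K) :
    wordSeries (closing ΞΩ ΞΓ fun _ q => q = []) =
      wordSeries (closing ΞΩ ΞΓ fun _ q => q = []) *
        (((Nat.card Γ * K : ℕ) : PowerSeries ℚ) * PowerSeries.X ^ 2) +
      wordSeries (descending ΞΩ ΞΓ) * wordSeries (arches ΞΩ ΞΓ) := by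
  conv_lhs => rw [closing_eq_union]
  rw [wordSeries_union disjoint_descentEnd_archEnd, wordSeries_descentEnd hΞΩ, wordSeries_archEnd]

lemma wordSeries_peaks {L : ℕ} (hΞΓ : ∀ γ, (ΞΓ γ).card = L) :
    wordSeries (peaks ΞΓ) = ((Nat.card Γ * L : ℕ) : PowerSeries ℚ) * PowerSeries.X ^ 3 := by
  have := Fintype.ofFinite Γ
  rw [peaks, ← gf_eq_wordSeries_range (ℓ := fun _ => 3), gf_const, Nat.card_sigma]
  · simp [hΞΓ]
  · rintro ⟨γ, ω, hω⟩ ⟨γ', ω', hω'⟩ h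
    simp at h
    obtain ⟨rfl, rfl⟩ := h
    rfl
  · simp

lemma wordSeries_arches {K L : ℕ} (hΞΩ : ∀ ω, (ΞΩ ω).card = K) (hΞΓ : ∀ γ, (ΞΓ γ).card = L) :
    wordSeries (arches ΞΩ ΞΓ) =
      ((Nat.card Γ * L : ℕ) : PowerSeries ℚ) * PowerSeries.X ^ 3 +
      wordSeries (balanced ΞΩ ΞΓ) * wordSeries (arches ΞΩ ΞΓ) *
        (((Nat.card Γ * K : ℕ) : PowerSeries ℚ) * PowerSeries.X ^ 3) := by
  conv_lhs => rw [arches_eq]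
  rw [wordSeries_union disjoint_peaks_highArches, wordSeries_peaks hΞΓ, highArches,
    wordSeries_descents hΞΩ (fun γ => [.neg γ]) (k := 1) (by simp),
    closing_eq_archEnd fun _ _ h => h.1, wordSeries_archEnd]

end Series

end Equations

/-! ### Classification of the periodic points. -/

section Points

variable {Γ Ω : Type*} {ΞΩ : Ω → Finset Ω} {ΞΓ : Γ → Finset Ω} {R : List Γ → List Γ → Prop}
  {x : ℤ → Symbol Γ Ω} {n : ℕ}

lemma subword_of_append {S : Type*} {x : ℤ → S} {i : ℤ} {n : ℕ} {a b c : List S}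
    (h : a ++ b ++ c = subword x i n) : subword x (i + a.length) b.length = b := by
  have hn : n = a.length + b.length + c.length := by
    have := congrArg List.length h
    simp only [List.length_append, length_subword] at this
    omega
  rw [hn, subword_add, subword_add] at h
  have h' := (List.append_inj' h (by simp)).1
  exact (List.append_inj' h' (by simp)).2.symm

lemma mem_xiShift_iff : x ∈ xiShift ΞΩ ΞΓ ↔
    ∀ i n, Admissible (subword x i n) ∧ FactorFree ΞΩ ΞΓ (subword x i n) := by
  constructor
  · rintro ⟨h₁, h₂⟩ i n
    refine ⟨h₁ i n, ?_⟩
    rintro f hf ⟨a, b, h⟩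
    exact h₂ f hf ⟨_, subword_of_append h⟩
  · intro h
    refine ⟨fun i n => (h i n).1, ?_⟩
    rintro f hf ⟨i, hi⟩
    exact (h i f.length).2 f hf ⟨[], [], by simp [hi]⟩

lemma not_appears (hx : x ∈ xiShift ΞΩ ΞΓ) {f : List (Symbol Γ Ω)} (hf : ExcludedWord ΞΩ ΞΓ f)
    (i : ℤ) : subword x i f.length ≠ f :=
  fun h => hx.2 f hf ⟨i, h⟩

lemma not_pair (hx : x ∈ xiShift ΞΩ ΞΓ) {i : ℤ} {a b : Symbol Γ Ω} (h : ExcludedWord ΞΩ ΞΓ [a, b])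
    (ha : x i = a) (hb : x (i + 1) = b) : False :=
  not_appears hx h i (by simp [subword, ha, hb])

lemma not_triple (hx : x ∈ xiShift ΞΩ ΞΓ) {i : ℤ} {a b c : Symbol Γ Ω}
    (h : ExcludedWord ΞΩ ΞΓ [a, b, c]) (ha : x i = a) (hb : x (i + 1) = b) (hc : x (i + 2) = c) :
    False :=
  not_appears hx h i (by simp [subword, ha, hb, hc])

lemma exists_loop_of_pos (hx : x ∈ xiShift ΞΩ ΞΓ) {i : ℤ} {γ : Γ} (h : x i = .pos γ) :
    ∃ ω, x (i + 1) = .loop ω := by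
  cases h' : x (i + 1) with
  | loop ω => exact ⟨ω, rfl⟩
  | pos γ' => exact (not_pair hx (.pos_pos γ γ') h h').elim
  | neg γ' => exact (not_pair hx (.pos_neg γ γ') h h').elim

/-- A position of a point that is not in the middle of a descent. -/
def IsCut (x : ℤ → Symbol Γ Ω) (i : ℤ) : Prop :=
  (∀ γ, x (i - 1) ≠ .pos γ) ∧ (∀ γ, x i ≠ .pos γ) ∧ ∀ ω γ, x i = .loop ω → x (i + 1) ≠ .pos γ

lemma subword_eq_append (x : ℤ → Symbol Γ Ω) (i : ℤ) (hn : n ≠ 0) :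
    subword x i n = subword x i (n - 1) ++ [x (i + n - 1)] := by
  obtain ⟨m, rfl⟩ := Nat.exists_eq_succ_of_ne_zero hn
  rw [subword_succ]
  simp only [Nat.succ_eq_add_one, Nat.add_sub_cancel, Nat.cast_add, Nat.cast_one]
  congr 3; ring

lemma subword_eq_cons (x : ℤ → Symbol Γ Ω) (i : ℤ) (hn : n ≠ 0) :
    subword x i n = x i :: subword x (i + 1) (n - 1) := by
  obtain ⟨m, rfl⟩ := Nat.exists_eq_succ_of_ne_zero hn
  rw [subword_succ']
  rfl

lemma clean_subword (hx : x ∈ xiShift ΞΩ ΞΓ) (hp : Function.Periodic x (n : ℤ)) (hn : n ≠ 0)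
    {i : ℤ} (hi : IsCut x i) : Clean ΞΩ ΞΓ (subword x i n) where
  free := (mem_xiShift_iff.1 hx i n).2
  last γ h := by
    rw [subword_eq_append x i hn, ← List.reverse_prefix] at h
    simp at h
    refine hi.1 γ ?_
    rw [h, ← hp (i - 1)]
    congr 1; ring
  first γ h := by
    rw [subword_eq_cons x i hn] at h
    simp at h
    exact hi.2.1 γ h.symm
  second ω γ h := by
    rw [subword_eq_cons x i hn] at h
    simp at h
    rcases eq_or_ne (n - 1) 0 with h0 | h0
    · simp [h0] at h
    · rw [subword_eq_cons x _ h0] at h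
      simp at h
      exact hi.2.2 ω γ h.1.symm h.2.symm

lemma isCut_of_clean (hp : Function.Periodic x (n : ℤ)) (hn : n ≠ 0) {i : ℤ}
    (h : Clean ΞΩ ΞΓ (subword x i n)) : IsCut x i := by
  refine ⟨fun γ hγ => h.last γ ?_, fun γ hγ => h.first γ ?_, fun ω γ hω hγ => ?_⟩
  · rw [subword_eq_append x i hn, ← List.reverse_prefix]
    rw [← hp (i - 1)] at hγ
    simp [← hγ]
    congr 1; ring
  · rw [subword_eq_cons x i hn]
    simp [hγ]
  · rcases eq_or_ne (n - 1) 0 with h0 | h0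
    · obtain rfl : n = 1 := by omega
      have := hp i
      simp [hω, hγ] at this
    · refine h.second ω γ ?_
      rw [subword_eq_cons x i hn, subword_eq_cons x _ h0]
      simp [hω, hγ]

lemma subword_rotate_one (hp : Function.Periodic x (n : ℤ)) (hn : n ≠ 0) (i : ℤ) :
    subword x (i + 1) n = subword x (i + 1) (n - 1) ++ [x i] := by
  have := subword_rotate (a := [x i]) (b := subword x (i + 1) (n - 1)) hp (subword_eq_cons x i hn)
  simpa using this

lemma run_rotate_loop (hp : Function.Periodic x (n : ℤ)) (hn : n ≠ 0) {i : ℤ} {ω : Ω}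
    (h : x i = .loop ω) : run (subword x (i + 1) n) = run (subword x i n) := by
  rw [subword_rotate_one hp hn, subword_eq_cons x i hn, h, run_concat, push_loop]
  simp [run]

lemma run_rotate_pos (hp : Function.Periodic x (n : ℤ)) (hn : n ≠ 0) {i : ℤ} {γ : Γ} {p : List Γ}
    (h : x i = .pos γ) (hr : run (subword x i n) = some (p, [])) :
    ∃ p', run (subword x (i + 1) n) = some (p', []) := by
  rw [subword_eq_cons x i hn] at hr
  obtain ⟨p', h'⟩ := run_right_eq_nil (u := [x i]) (v := subword x (i + 1) (n - 1)) hr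
  exact ⟨γ :: p', by rw [subword_rotate_one hp hn, run_concat, h', h, push_pos_nil]⟩

/-- One step to the right, over a letter of Ω that does not change the normal form, leaves the
middle of γ(+)ω. The other conditions for a cut hold because no γ(+) is unmatched. -/
lemma exists_ascending (hx : x ∈ xiShift ΞΩ ΞΓ) (hp : Function.Periodic x (n : ℤ)) (hn : n ≠ 0)
    {i : ℤ} {q : List Γ} (hr : run (subword x i n) = some ([], q)) :
    x ∈ circ (ascending ΞΩ ΞΓ) n := by
  obtain ⟨j, hj, hrj⟩ : ∃ j, (∀ γ, x (j - 1) ≠ .pos γ) ∧ run (subword x j n) = some ([], q) := by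
    by_cases h : ∃ γ, x (i - 1) = .pos γ
    · obtain ⟨γ, h⟩ := h
      obtain ⟨ω, hω⟩ := exists_loop_of_pos hx h
      rw [sub_add_cancel] at hω
      exact ⟨i + 1, by simp [hω], by rw [run_rotate_loop hp hn hω, hr]⟩
    · push Not at h
      exact ⟨i, h, hr⟩
  refine ⟨hp, j, clean_subword hx hp hn ⟨hj, ?_, ?_⟩, [], q, hrj, rfl⟩
  · intro γ h
    rw [subword_eq_cons x j hn, h] at hrj
    obtain ⟨q', h'⟩ := run_left_eq_nil (u := [.pos γ]) hrj
    simp [run, push] at h'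
  · intro ω γ hω h
    rw [← run_rotate_loop hp hn hω, subword_eq_cons x _ hn, h] at hrj
    obtain ⟨q', h'⟩ := run_left_eq_nil (u := [.pos γ]) hrj
    simp [run, push] at h'

/-- From the position `i` on, the point `x` is an alternating sequence of letters in `Ω` and of
`γ(+)`, where the letters in `Ω` follow each other according to `ΞΩ`. -/
def AltFrom (ΞΩ : Ω → Finset Ω) (x : ℤ → Symbol Γ Ω) (i : ℤ) : Prop :=
  ∀ k : ℤ, ∃ ω γ ω', x (i + 2 * k) = .loop ω ∧ x (i + 2 * k + 1) = .pos γ ∧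
    x (i + 2 * k + 2) = .loop ω' ∧ ω' ∈ ΞΩ ω

/-- Without a cut whose normal form has only γ(+), every step of a descent forces the next one, and
by periodicity the descent fills the point. -/
lemma exists_descending_or_alt (hx : x ∈ xiShift ΞΩ ΞΓ) (hp : Function.Periodic x (n : ℤ))
    (hn : n ≠ 0) {i : ℤ} {p : List Γ} (hr : run (subword x i n) = some (p, [])) :
    x ∈ circ (descending ΞΩ ΞΓ) n ∨ ∃ i, AltFrom ΞΩ x i := by
  by_cases hcut : ∃ j p', IsCut x j ∧ run (subword x j n) = some (p', [])
  · obtain ⟨j, p', hj, hrj⟩ := hcut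
    exact Or.inl ⟨hp, j, clean_subword hx hp hn hj, p', [], hrj, rfl⟩
  right
  push Not at hcut
  -- The positions right after a γ(+) from which a period has no unmatched γ(-).
  let E : ℤ → Prop := fun j => (∃ p', run (subword x j n) = some (p', [])) ∧ ∃ γ, x (j - 1) = .pos γ
  have hloop : ∀ j, E j → ∃ ω, x j = .loop ω := by
    rintro j ⟨-, γ, h⟩
    simpa using exists_loop_of_pos hx h
  have hpos : ∀ j, E j → ∃ γ, x (j + 1) = .pos γ := by
    intro j hE
    obtain ⟨ω, hω⟩ := hloop j hE
    obtain ⟨⟨p', hrj⟩, γ, h⟩ := hE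
    by_contra hcon
    push Not at hcon
    -- If the letter of Ω at `j` were not followed by γ(+), then `j + 1` would be a cut, because
    -- ωω'γ(+) is excluded.
    refine hcut (j + 1) p' ⟨by simp [hω], hcon, ?_⟩ (by rw [run_rotate_loop hp hn hω, hrj])
    intro ω' γ' h₁ h₂
    exact not_triple hx (.loop_loop_pos ω ω' γ') hω h₁ (by rw [← h₂]; congr 1; ring)
  have hstep : ∀ j, E j → E (j + 2) := by
    intro j hE
    obtain ⟨ω, hω⟩ := hloop j hE
    obtain ⟨γ', hγ'⟩ := hpos j hE
    obtain ⟨⟨p', hrj⟩, γ, h⟩ := hE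
    rw [← run_rotate_loop hp hn hω] at hrj
    have := run_rotate_pos hp hn hγ' hrj
    rw [show j + 1 + 1 = j + 2 by ring] at this
    exact ⟨this, γ', by rw [← hγ']; congr 1; ring⟩
  obtain ⟨j, hj⟩ : ∃ j, E j := by
    by_cases h₁ : ∃ γ, x (i - 1) = .pos γ
    · exact ⟨i, ⟨p, hr⟩, h₁⟩
    by_cases h₂ : ∃ γ, x i = .pos γ
    · obtain ⟨γ, h₂⟩ := h₂
      exact ⟨i + 1, run_rotate_pos hp hn h₂ hr, γ, by simpa using h₂⟩
    by_cases h₃ : ∃ ω γ, x i = .loop ω ∧ x (i + 1) = .pos γ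
    · obtain ⟨ω, γ, hω, hγ⟩ := h₃
      rw [← run_rotate_loop hp hn hω] at hr
      exact ⟨i + 1 + 1, run_rotate_pos hp hn hγ hr, γ, by simpa using hγ⟩
    · push Not at h₁ h₂ h₃
      exact absurd hr (hcut i p ⟨h₁, h₂, h₃⟩)
  have hE : ∀ k : ℕ, E (j + 2 * k) := by
    intro k
    induction k with
    | zero => simpa using hj
    | succ k ih =>
      have := hstep _ ih
      rwa [show j + 2 * (k : ℤ) + 2 = j + 2 * ((k + 1 : ℕ) : ℤ) by push_cast; ring] at this
  refine ⟨j, fun k => ?_⟩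
  -- `E` is only propagated forwards. Adding `2n|k|`, a multiple of the period, brings the negative
  -- `k` into that range.
  have hshift : ∀ a : ℤ, x (a + 2 * k) = x (a + 2 * ((k + n * k.natAbs).toNat : ℕ)) := by
    intro a
    have h0 : 0 ≤ k + n * k.natAbs := by
      have : (1 : ℤ) ≤ n := by exact_mod_cast Nat.one_le_iff_ne_zero.2 hn
      have h2 : -k ≤ k.natAbs := by omega
      nlinarith
    rw [Int.toNat_of_nonneg h0]
    rw [show a + 2 * (k + n * (k.natAbs : ℤ)) = a + 2 * k + (2 * k.natAbs : ℤ) * n by ring]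
    exact (hp.int_mul (2 * k.natAbs) _).symm
  set m := (k + n * k.natAbs).toNat
  obtain ⟨ω, hω⟩ := hloop _ (hE m)
  obtain ⟨γ, hγ⟩ := hpos _ (hE m)
  obtain ⟨ω', hω'⟩ := hloop _ (hstep _ (hE m))
  refine ⟨ω, γ, ω', (hshift j).trans hω, ?_, ?_, ?_⟩
  · rw [← hγ, show j + 2 * k + 1 = j + 1 + 2 * k by ring, hshift]
    congr 1; ring
  · rw [← hω', show j + 2 * k + 2 = j + 2 + 2 * k by ring, hshift]
    congr 1; ring
  · by_contra hcon
    exact not_triple hx (.loop_pos_loop γ ω ω' hcon) hω hγ hω'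

lemma subword_mul_mem {S : Type*} {M : Set (List S)} (hM : VeryPure M) {x : ℤ → S} {n : ℕ}
    (hp : Function.Periodic x (n : ℤ)) {i : ℤ} (h : subword x i n ∈ M) (a : ℤ) (b : ℕ) :
    subword x (i + a * n) (b * n) ∈ M := by
  induction b with
  | zero => simpa using hM.nil
  | succ b ih =>
    rw [add_mul, one_mul, subword_add]
    refine hM.append ih ?_
    rw [subword_congr_emod hp (j := i) ⟨a + b, by push_cast; ring⟩]
    exact h

/-- Every window of the point lies inside a concatenation of repeated blocks, which is again a clean
word with a normal form. -/
lemma circ_subset (hM : VeryPure (lang ΞΩ ΞΓ R)) (hn : n ≠ 0) :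
    circ (lang ΞΩ ΞΓ R) n ⊆ periodicPoints (xiShift ΞΩ ΞΓ) n := by
  rintro x ⟨hp, i, hi⟩
  refine ⟨mem_xiShift_iff.2 fun j m => ?_, hp⟩
  have hn' : (1 : ℤ) ≤ n := by exact_mod_cast Nat.one_le_iff_ne_zero.2 hn
  obtain ⟨c, hc⟩ : ∃ c : ℕ, j = i + (-((i - j).natAbs : ℤ)) * n + c := by
    have : i + (-((i - j).natAbs : ℤ)) * n ≤ j := by
      have : i - j ≤ (i - j).natAbs := by omega
      nlinarith
    exact ⟨(j - (i + (-((i - j).natAbs : ℤ)) * n)).toNat, by omega⟩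
  obtain ⟨d, hd⟩ : ∃ d, (c + m) * n = c + m + d :=
    ⟨(c + m) * n - (c + m), by have := Nat.le_mul_of_pos_right (c + m) (Nat.pos_of_ne_zero hn); omega⟩
  obtain ⟨hclean, p, q, hr, -⟩ := subword_mul_mem hM hp hi (-((i - j).natAbs : ℤ)) (c + m)
  rw [hd, subword_add, subword_add, ← hc] at hclean hr
  have hinf := List.infix_append (subword x (i + (-((i - j).natAbs : ℤ)) * n) c) (subword x j m)
    (subword x (i + (-((i - j).natAbs : ℤ)) * n + (c + m : ℕ)) d)
  exact ⟨(admissible_iff.2 ⟨p, q, hr⟩).infix hinf, hclean.free.infix hinf⟩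

lemma run_of_no_neg {w : List (Symbol Γ Ω)} (h : ∀ γ, .neg γ ∉ w) : ∃ p, run w = some (p, []) := by
  induction w using List.reverseRecOn with
  | nil => exact ⟨[], rfl⟩
  | append_singleton w s ih =>
    obtain ⟨p, hp⟩ := ih fun γ hγ => h γ (by simp [hγ])
    cases s with
    | neg γ => exact absurd (by simp) (h γ)
    | pos γ => exact ⟨γ :: p, by simp [run_concat, hp]⟩
    | loop ω => exact ⟨p, by simp [run_concat, hp]⟩

/-- The alternating points of period `n`. -/
def altPoints (Γ : Type*) {Ω : Type*} (ΞΩ : Ω → Finset Ω) (n : ℕ) : Set (ℤ → Symbol Γ Ω) :=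
  {x | Function.Periodic x (n : ℤ) ∧ ∃ i, AltFrom ΞΩ x i}

lemma AltFrom.cases {i : ℤ} (h : AltFrom ΞΩ x i) (j : ℤ) :
    (∃ ω γ ω', x j = .loop ω ∧ x (j + 1) = .pos γ ∧ x (j + 2) = .loop ω' ∧ ω' ∈ ΞΩ ω) ∨
      ∃ ω γ, x j = .pos γ ∧ x (j + 1) = .loop ω := by
  rcases Int.even_or_odd' (j - i) with ⟨k, hk | hk⟩
  · obtain ⟨ω, γ, ω', h₁, h₂, h₃, h₄⟩ := h k
    rw [show i + 2 * k = j by omega] at h₁ h₂ h₃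
    exact Or.inl ⟨ω, γ, ω', h₁, h₂, h₃, h₄⟩
  · obtain ⟨ω, γ, ω', h₁, h₂, h₃, h₄⟩ := h k
    rw [show i + 2 * k + 1 = j by omega] at h₂
    rw [show i + 2 * k + 2 = j + 1 by omega] at h₃
    exact Or.inr ⟨ω', γ, h₂, h₃⟩

lemma AltFrom.mem_xiShift {i : ℤ} (h : AltFrom ΞΩ x i) : x ∈ xiShift ΞΩ ΞΓ := by
  refine ⟨fun j n => ?_, ?_⟩
  · refine admissible_iff.2 ?_
    obtain ⟨p, hp⟩ := run_of_no_neg (w := subword x j n) (by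
      intro γ hγ
      simp only [subword, List.mem_ofFn] at hγ
      obtain ⟨k, hk⟩ := hγ
      rcases h.cases (j + (k : ℕ)) with ⟨ω, γ', ω', h₁, -⟩ | ⟨ω, γ', h₁, -⟩ <;> simp [h₁] at hk)
    exact ⟨p, [], hp⟩
  · rintro f hf ⟨j, hj⟩
    have hc := h.cases j
    have hc' := h.cases (j + 1)
    rw [show j + 1 + 1 = j + 2 by ring] at hc'
    cases hf <;> simp [subword] at hj <;> simp [hj] at hc hc'
    case loop_pos_loop γ ω ω' hω =>
      exact hω (hc)

/-- In an endless descent every position is a γ(+) or an ω followed by γ(+), so there is no cut. -/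
lemma disjoint_altPoints (hn : n ≠ 0) :
    Disjoint (altPoints Γ ΞΩ n) (circ (lang ΞΩ ΞΓ R) n) := by
  rw [Set.disjoint_left]
  rintro x ⟨hp, i, hi⟩ ⟨-, j, hj⟩
  have hcut := isCut_of_clean hp hn hj.1
  rcases hi.cases j with ⟨ω, γ, ω', h₁, h₂, -⟩ | ⟨ω, γ, h₁, -⟩
  · exact hcut.2.2 ω γ h₁ h₂
  · exact hcut.2.1 γ h₁

/-- The height of a period is invariant under rotation, so representatives cut at different places
can be compared. -/
lemma sum_height_subword (hp : Function.Periodic x (n : ℤ)) (hn : n ≠ 0) (i j : ℤ) :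
    ((subword x i n).map Symbol.height).sum = ((subword x j n).map Symbol.height).sum := by
  have hn' : (0 : ℤ) < n := by positivity
  obtain ⟨m, hm⟩ : ∃ m : ℕ, (m : ℤ) = (j - i) % n :=
    ⟨((j - i) % n).toNat, Int.toNat_of_nonneg (Int.emod_nonneg _ hn'.ne')⟩
  have hmn : m < n := by
    have := Int.emod_lt_of_pos (j - i) hn'
    omega
  have hsplit : subword x i n = subword x i m ++ subword x (i + m) (n - m) := by
    rw [← subword_add, Nat.add_sub_cancel' hmn.le]
  have hrot := subword_rotate hp hsplit
  rw [length_subword] at hrot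
  have hj : subword x j n = subword x (i + m) n := by
    refine subword_congr_emod hp ⟨(j - i) / n, ?_⟩ n
    rw [hm]
    have := Int.emod_add_mul_ediv (j - i) n
    linear_combination -this
  rw [hj, hrot, hsplit]
  simp [add_comm]

/-- The height is nonnegative for an ascending representative and nonpositive for a descending one.
Hence it is zero, and the ascending word is already balanced. -/
lemma circ_inter (hn : n ≠ 0) :
    circ (ascending ΞΩ ΞΓ) n ∩ circ (descending ΞΩ ΞΓ) n = circ (balanced ΞΩ ΞΓ) n := by
  ext x
  constructor
  · rintro ⟨⟨hp, i, hc, _, q, hr, rfl⟩, -, j, -, p, _, hr', rfl⟩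
    have h := sum_height_subword hp hn i j
    rw [sum_height hr, sum_height hr'] at h
    simp only [List.length_nil] at h
    obtain rfl : q = [] := List.length_eq_zero_iff.1 (by omega)
    exact ⟨hp, i, hc, _, _, hr, rfl, rfl⟩
  · rintro ⟨hp, i, hi⟩
    rw [mem_balanced_iff] at hi
    exact ⟨⟨hp, i, hi.1⟩, ⟨hp, i, hi.2⟩⟩

lemma periodicPoints_eq (hn : n ≠ 0) : periodicPoints (xiShift ΞΩ ΞΓ) n =
    altPoints Γ ΞΩ n ∪ (circ (ascending ΞΩ ΞΓ) n ∪ circ (descending ΞΩ ΞΓ) n) := by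
  refine Set.Subset.antisymm ?_ (Set.union_subset ?_ (Set.union_subset
    (circ_subset veryPure_ascending hn) (circ_subset veryPure_descending hn)))
  · rintro x ⟨hx, hp⟩
    replace hp : Function.Periodic x (n : ℤ) := hp
    obtain ⟨p, q, hr⟩ := admissible_iff.1 (mem_xiShift_iff.1 hx 0 n).1
    obtain ⟨u, v, huv, h⟩ := run_rotate hr
    have hrot := subword_rotate hp huv
    rw [← hrot] at h
    rcases h (mem_xiShift_iff.1 hx _ n).1 with ⟨q', hr'⟩ | ⟨p', hr'⟩
    · exact Or.inr (Or.inl (exists_ascending hx hp hn hr'))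
    · rcases exists_descending_or_alt hx hp hn hr' with h | h
      · exact Or.inr (Or.inr h)
      · exact Or.inl ⟨hp, h⟩
  · rintro x ⟨hp, i, hi⟩
    exact ⟨hi.mem_xiShift, hp⟩

lemma ncard_periodicPoints [Finite Γ] [Finite Ω] (hn : n ≠ 0) :
    (periodicPoints (xiShift ΞΩ ΞΓ) n).ncard + (circ (balanced ΞΩ ΞΓ) n).ncard =
      (altPoints Γ ΞΩ n).ncard + (circ (ascending ΞΩ ΞΓ) n).ncard +
        (circ (descending ΞΩ ΞΓ) n).ncard := by
  have hfin := finite_periodic (S := Symbol Γ Ω) hn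
  have h₁ : (altPoints Γ ΞΩ n).Finite := hfin.subset fun x hx => hx.1
  have h₂ (M : Set (List (Symbol Γ Ω))) : (circ M n).Finite := hfin.subset fun x hx => hx.1
  rw [periodicPoints_eq hn, Set.ncard_union_eq (Set.disjoint_union_right.2
    ⟨disjoint_altPoints hn, disjoint_altPoints hn⟩) h₁ ((h₂ _).union (h₂ _)), ← circ_inter hn,
    add_assoc, add_assoc, Set.ncard_union_add_ncard_inter _ _ (h₂ _) (h₂ _)]

end Points

/-! ### Counting the endless descents by traces. -/

section ClosedWalks

variable {Γ Ω : Type*} {ΞΩ : Ω → Finset Ω}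

/-- The walks of length `m` from `a` to `b`, given by the words of the vertices after `a`. -/
def walks (ΞΩ : Ω → Finset Ω) (a : Ω) : ℕ → Ω → Set (List Ω)
  | 0, b => {l | l = [] ∧ a = b}
  | m + 1, b => {l | ∃ c, b ∈ ΞΩ c ∧ ∃ l' ∈ walks ΞΩ a m c, l = l' ++ [b]}

lemma length_of_mem_walks {a b : Ω} {m : ℕ} {l : List Ω} (h : l ∈ walks ΞΩ a m b) :
    l.length = m := by
  induction m generalizing b l with
  | zero => simp [h.1]
  | succ m ih =>
    obtain ⟨c, -, l', hl', rfl⟩ := h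
    simp [ih hl']

lemma walks_unique {a b c : Ω} {m : ℕ} {l : List Ω} (hb : l ∈ walks ΞΩ a m b)
    (hc : l ∈ walks ΞΩ a m c) : b = c := by
  cases m with
  | zero => rw [← hb.2, hc.2]
  | succ m =>
    obtain ⟨-, -, l₁, -, rfl⟩ := hb
    obtain ⟨-, -, l₂, -, h⟩ := hc
    simpa using (List.append_inj' h rfl).2

lemma subword_mem_walks {y : ℤ → Ω} {i : ℤ} {m : ℕ} {b : Ω} :
    subword y (i + 1) m ∈ walks ΞΩ (y i) m b ↔
      (∀ k < m, y (i + k + 1) ∈ ΞΩ (y (i + k))) ∧ y (i + m) = b := by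
  induction m generalizing b with
  | zero => simp [walks]
  | succ m ih =>
    have e : y (i + 1 + m) = y (i + (m + 1 : ℕ)) := by congr 1; push_cast; ring
    have e' : y (i + m + 1) = y (i + (m + 1 : ℕ)) := by congr 1; push_cast; ring
    constructor
    · rintro ⟨c, hbc, l, hl, h⟩
      rw [subword_succ] at h
      obtain ⟨rfl, h₂⟩ := List.append_inj' h rfl
      obtain ⟨h₃, rfl⟩ := ih.1 hl
      simp only [List.cons.injEq, and_true, e] at h₂
      refine ⟨fun k hk => ?_, h₂⟩
      rcases Nat.lt_succ_iff_lt_or_eq.1 hk with hk | rfl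
      · exact h₃ k hk
      · rw [e', h₂]; exact hbc
    · rintro ⟨h, rfl⟩
      refine ⟨y (i + m), by rw [← e']; exact h m (by omega), _,
        ih.2 ⟨fun k hk => h k (by omega), rfl⟩, ?_⟩
      rw [subword_succ, e]

lemma finite_walks [Finite Ω] (a b : Ω) (m : ℕ) : Finite (walks ΞΩ a m b) :=
  ((List.finite_length_eq Ω m).subset fun _ h => length_of_mem_walks h).to_subtype

lemma card_walks [Fintype Ω] [DecidableEq Ω] (a b : Ω) (m : ℕ) :
    (Nat.card (walks ΞΩ a m b) : ℤ) = (transitionMatrix ΞΩ ^ m) a b := by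
  induction m generalizing b with
  | zero =>
    by_cases h : a = b
    · subst h
      have : walks ΞΩ a 0 a = {[]} := by ext; simp [walks]
      simp [this]
    · have : walks ΞΩ a 0 b = ∅ := by ext; simp [walks, h]
      simp [this, h]
  | succ m ih =>
    let f : (Σ c : {c // b ∈ ΞΩ c}, walks ΞΩ a m c.1) → walks ΞΩ a (m + 1) b :=
      fun x => ⟨x.2.1 ++ [b], x.1.1, x.1.2, x.2.1, x.2.2, rfl⟩
    have hf : Function.Bijective f := by
      constructor
      · rintro ⟨⟨c, hc⟩, ⟨l, hl⟩⟩ ⟨⟨c', hc'⟩, ⟨l', hl'⟩⟩ h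
        obtain ⟨rfl, -⟩ := List.append_inj' (congrArg Subtype.val h) rfl
        obtain rfl := walks_unique hl hl'
        rfl
      · rintro ⟨_, c, hc, l, hl, rfl⟩
        exact ⟨⟨⟨c, hc⟩, ⟨l, hl⟩⟩, rfl⟩
    have := fun c => finite_walks (ΞΩ := ΞΩ) a c m
    rw [← Nat.card_congr (Equiv.ofBijective f hf), Nat.card_sigma, pow_succ, Matrix.mul_apply]
    push_cast
    simp only [ih, transitionMatrix, Matrix.of_apply, mul_ite, mul_one, mul_zero]
    rw [← Finset.sum_filter]
    exact (Finset.sum_subtype (Finset.univ.filter fun c => b ∈ ΞΩ c) (by simp)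
      (fun c => (transitionMatrix ΞΩ ^ m) a c)).symm

/-- The closed walks of length `m`, as periodic sequences. -/
def closedWalks (ΞΩ : Ω → Finset Ω) (m : ℕ) : Set (ℤ → Ω) :=
  {y | Function.Periodic y (m : ℤ) ∧ ∀ k, y (k + 1) ∈ ΞΩ (y k)}

lemma periodic_walk {y : ℤ → Ω} {m : ℕ} (hm : m ≠ 0) (hy : Function.Periodic y (m : ℤ))
    (h : ∀ k < m, y (0 + k + 1) ∈ ΞΩ (y (0 + k))) (k : ℤ) : y (k + 1) ∈ ΞΩ (y k) := by
  have hm' : (0 : ℤ) < m := by positivity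
  obtain ⟨j, hj⟩ : ∃ j : ℕ, (j : ℤ) = k % m :=
    ⟨(k % m).toNat, Int.toNat_of_nonneg (Int.emod_nonneg _ hm'.ne')⟩
  have hjm : j < m := by
    have := Int.emod_lt_of_pos k hm'
    omega
  have hk : k = 0 + j + k / m * m := by
    have := Int.emod_add_mul_ediv k m
    rw [hj]; linear_combination -this
  have h₁ : y k = y (0 + j) := by
    rw [hk]; exact (hy.int_mul _ _)
  have h₂ : y (k + 1) = y (0 + j + 1) := by
    rw [show k + 1 = 0 + j + 1 + k / m * m by linear_combination hk]
    exact (hy.int_mul _ _)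
  rw [h₁, h₂]
  exact h j hjm

lemma card_closedWalks [Fintype Ω] [DecidableEq Ω] {m : ℕ} (hm : m ≠ 0) :
    (Nat.card (closedWalks ΞΩ m) : ℤ) = (transitionMatrix ΞΩ ^ m).trace := by
  have hmem (y : closedWalks ΞΩ m) : subword y.1 1 m ∈ walks ΞΩ (y.1 0) m (y.1 0) := by
    have := (subword_mem_walks (ΞΩ := ΞΩ) (y := y.1) (i := 0) (m := m) (b := y.1 0)).2
      ⟨fun k _ => y.2.2 _, y.2.1 0⟩
    simpa using this
  let f : closedWalks ΞΩ m → Σ a, walks ΞΩ a m a := fun y => ⟨y.1 0, subword y.1 1 m, hmem y⟩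
  have hf : Function.Bijective f := by
    constructor
    · intro y y' h
      refine Subtype.ext (eq_of_subword_eq y.2.1 y'.2.1 hm (i := 1) ?_)
      exact congrArg (fun z : Σ a, walks ΞΩ a m a => z.2.1) h
    · rintro ⟨a, l, hl⟩
      obtain rfl := length_of_mem_walks hl
      obtain ⟨y, hy, hyl⟩ := exists_periodic l (by rintro rfl; exact hm rfl) 1
      -- The list holds the vertices after `a`; for a closed walk its last entry is `a`, which
      -- periodicity carries to position 0.
      have h0 : y 0 = a := by
        obtain ⟨k, hk⟩ := Nat.exists_eq_succ_of_ne_zero hm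
        have hl' := hl
        rw [hk] at hl' hyl
        obtain ⟨c, -, l', -, h⟩ := hl'
        rw [h, subword_succ] at hyl
        have := (List.append_inj' hyl rfl).2
        simp at this
        rw [← this, ← hy 0, hk]
        congr 1; push_cast; ring
      subst h0
      rw [← hyl] at hl
      have hw := (subword_mem_walks (ΞΩ := ΞΩ) (y := y) (i := 0) (m := l.length) (b := y 0)).1
        (by simpa [hyl] using hl)
      refine ⟨⟨y, hy, periodic_walk hm hy hw.1⟩, ?_⟩
      simp only [f]
      congr 2
  have := fun c => finite_walks (ΞΩ := ΞΩ) c c m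
  rw [Nat.card_congr (Equiv.ofBijective f hf), Nat.card_sigma]
  rw [Nat.cast_sum]
  simp only [card_walks, Matrix.trace, Matrix.diag]

lemma card_periodic [Finite Γ] {m : ℕ} (hm : m ≠ 0) :
    Nat.card {c : ℤ → Γ // Function.Periodic c (m : ℤ)} = Nat.card Γ ^ m := by
  let f : {c : ℤ → Γ // Function.Periodic c (m : ℤ)} → (Fin m → Γ) := fun c k => c.1 (0 + (k : ℕ))
  have hf : Function.Bijective f := by
    constructor
    · intro c c' h
      refine Subtype.ext (eq_of_subword_eq c.2 c'.2 hm (i := 0) ?_)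
      exact congrArg List.ofFn h
    · intro g
      obtain ⟨c, hc, h⟩ := exists_periodic (List.ofFn g) (by simpa using hm) 0
      rw [List.length_ofFn] at hc h
      exact ⟨⟨c, hc⟩, List.ofFn_injective h⟩
  rw [Nat.card_congr (Equiv.ofBijective f hf), Nat.card_fun, Nat.card_fin]

/-- The alternating point with the given letters, starting at the position `i`. -/
def altPoint (i : ℤ) (y : ℤ → Ω) (c : ℤ → Γ) (j : ℤ) : Symbol Γ Ω :=
  if (j - i) % 2 = 0 then .loop (y ((j - i) / 2)) else .pos (c ((j - i) / 2))

lemma altPoint_loop (i : ℤ) (y : ℤ → Ω) (c : ℤ → Γ) (k : ℤ) :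
    altPoint i y c (i + 2 * k) = .loop (y k) := by
  simp [altPoint]

lemma altPoint_pos (i : ℤ) (y : ℤ → Ω) (c : ℤ → Γ) (k : ℤ) :
    altPoint i y c (i + 2 * k + 1) = .pos (c k) := by
  have h₁ : i + 2 * k + 1 - i = 2 * k + 1 := by ring
  have h₂ : (2 * k + 1) % 2 = 1 := by omega
  have h₃ : (2 * k + 1) / 2 = k := by omega
  simp [altPoint, h₁, h₂, h₃]

/-- Such a point interleaves a closed walk of length `m` with an arbitrary `m`-periodic sequence in
Γ. -/
lemma card_altFrom [Finite Γ] [Fintype Ω] [DecidableEq Ω] {m : ℕ} (hm : m ≠ 0) (i : ℤ) :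
    (({x : ℤ → Symbol Γ Ω | Function.Periodic x ((2 * m : ℕ) : ℤ) ∧ AltFrom ΞΩ x i}.ncard : ℕ) : ℤ) =
      (Nat.card Γ : ℤ) ^ m * (transitionMatrix ΞΩ ^ m).trace := by
  set X := {x : ℤ → Symbol Γ Ω | Function.Periodic x ((2 * m : ℕ) : ℤ) ∧ AltFrom ΞΩ x i}
  have hmem (z : closedWalks ΞΩ m × {c : ℤ → Γ // Function.Periodic c (m : ℤ)}) :
      altPoint i z.1.1 z.2.1 ∈ X := by
    refine ⟨fun j => ?_, fun k => ⟨_, _, _, altPoint_loop .., altPoint_pos .., ?_, z.1.2.2 k⟩⟩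
    · have h₁ : (j + (2 * m : ℕ) - i) % 2 = (j - i) % 2 := by push_cast; omega
      have h₂ : (j + (2 * m : ℕ) - i) / 2 = (j - i) / 2 + m := by push_cast; omega
      simp only [altPoint, h₁, h₂, z.1.2.1 _, z.2.2 _]
    · rw [← altPoint_loop i z.1.1 z.2.1]
      congr 1; ring
  let f : closedWalks ΞΩ m × {c : ℤ → Γ // Function.Periodic c (m : ℤ)} → X :=
    fun z => ⟨altPoint i z.1.1 z.2.1, hmem z⟩
  have hf : Function.Bijective f := by
    constructor
    · rintro ⟨⟨y, hy⟩, ⟨c, hc⟩⟩ ⟨⟨y', hy'⟩, ⟨c', hc'⟩⟩ h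
      have h' : altPoint i y c = altPoint i y' c' := congrArg Subtype.val h
      obtain rfl : y = y' := by
        ext k
        have := congrFun h' (i + 2 * k)
        simpa [altPoint_loop] using this
      obtain rfl : c = c' := by
        ext k
        have := congrFun h' (i + 2 * k + 1)
        simpa [altPoint_pos] using this
      rfl
    · rintro ⟨x, hx, halt⟩
      choose y c y' h₁ h₂ h₃ h₄ using id halt
      have hy' : ∀ k, y' k = y (k + 1) := by
        intro k
        have := h₁ (k + 1)
        rw [show i + 2 * (k + 1) = i + 2 * k + 2 by ring, h₃] at this
        simpa using this
      have hy : Function.Periodic y (m : ℤ) := by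
        intro k
        have := hx (i + 2 * k)
        rw [h₁, show i + 2 * k + ((2 * m : ℕ) : ℤ) = i + 2 * (k + m) by push_cast; ring, h₁] at this
        simpa using this
      have hc : Function.Periodic c (m : ℤ) := by
        intro k
        have := hx (i + 2 * k + 1)
        rw [h₂, show i + 2 * k + 1 + ((2 * m : ℕ) : ℤ) = i + 2 * (k + m) + 1 by push_cast; ring,
          h₂] at this
        simpa using this
      refine ⟨(⟨y, hy, fun k => hy' k ▸ h₄ k⟩, ⟨c, hc⟩), Subtype.ext ?_⟩
      ext j
      change altPoint i y c j = x j
      rcases Int.even_or_odd' (j - i) with ⟨k, hk | hk⟩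
      · obtain rfl : j = i + 2 * k := by omega
        rw [altPoint_loop, h₁]
      · obtain rfl : j = i + 2 * k + 1 := by omega
        rw [altPoint_pos, h₂]
  rw [← Nat.card_coe_set_eq, ← Nat.card_congr (Equiv.ofBijective f hf), Nat.card_prod,
    card_periodic hm]
  push_cast
  rw [card_closedWalks hm, mul_comm]

lemma AltFrom.shift {x : ℤ → Symbol Γ Ω} {i : ℤ} (h : AltFrom ΞΩ x i) (a : ℤ) :
    AltFrom ΞΩ x (i + 2 * a) := by
  intro k
  have := h (a + k)
  rwa [show i + 2 * (a + k) = i + 2 * a + 2 * k by ring] at this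

lemma AltFrom.not_odd {x : ℤ → Symbol Γ Ω} {i : ℤ} (h : AltFrom ΞΩ x i) :
    ¬ AltFrom ΞΩ x (i + 1) := by
  intro h'
  obtain ⟨ω, γ, ω', -, h₁, -⟩ := h 0
  obtain ⟨ω₂, γ₂, ω₂', h₂, -⟩ := h' 0
  rw [show i + 1 + 2 * 0 = i + 2 * 0 + 1 by ring, h₁] at h₂
  simp at h₂

/-- The letters of Ω occupy the even or the odd positions, hence the factor 2. A shift by an odd
period would exchange the two parities. -/
lemma ncard_altPoints [Finite Γ] [Fintype Ω] [DecidableEq Ω] {n : ℕ} (hn : n ≠ 0) :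
    ((altPoints Γ ΞΩ n).ncard : ℤ) = if Even n then 2 * (Nat.card Γ : ℤ) ^ (n / 2) *
      (transitionMatrix ΞΩ ^ (n / 2)).trace else 0 := by
  split_ifs with h
  · obtain ⟨m, rfl⟩ := h.two_dvd
    have hm : m ≠ 0 := by omega
    have hsplit : altPoints Γ ΞΩ (2 * m) =
        {x | Function.Periodic x ((2 * m : ℕ) : ℤ) ∧ AltFrom ΞΩ x 0} ∪
        {x | Function.Periodic x ((2 * m : ℕ) : ℤ) ∧ AltFrom ΞΩ x 1} := by
      ext x
      constructor
      · rintro ⟨hp, i, hi⟩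
        have := hi.shift (-(i / 2))
        rcases Int.emod_two_eq_zero_or_one i with h2 | h2
        · rw [show i + 2 * -(i / 2) = 0 by omega] at this
          exact Or.inl ⟨hp, this⟩
        · rw [show i + 2 * -(i / 2) = 1 by omega] at this
          exact Or.inr ⟨hp, this⟩
      · rintro (⟨hp, h⟩ | ⟨hp, h⟩) <;> exact ⟨hp, _, h⟩
    have hfin := finite_periodic (S := Symbol Γ Ω) hn
    rw [hsplit, Set.ncard_union_eq _ (hfin.subset fun x hx => hx.1) (hfin.subset fun x hx => hx.1)]
    · push_cast
      have h₀ := card_altFrom (Γ := Γ) (ΞΩ := ΞΩ) hm 0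
      have h₁ := card_altFrom (Γ := Γ) (ΞΩ := ΞΩ) hm 1
      push_cast at h₀ h₁
      rw [h₀, h₁, Nat.mul_div_cancel_left m two_pos]
      ring
    · rw [Set.disjoint_left]
      rintro x ⟨-, h₀⟩ ⟨-, h₁⟩
      exact h₀.not_odd (by simpa using h₁)
  · have : altPoints Γ ΞΩ n = ∅ := by
      rw [Set.eq_empty_iff_forall_notMem]
      rintro x ⟨hp, i, hi⟩
      obtain ⟨k, hk⟩ := Nat.not_even_iff_odd.1 h
      refine (hi.shift k).not_odd fun j => ?_
      obtain ⟨ω, γ, ω', h₁, h₂, h₃, h₄⟩ := hi j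
      refine ⟨ω, γ, ω', ?_, ?_, ?_, h₄⟩
      · rw [← h₁, ← hp (i + 2 * j), hk]; congr 1; push_cast; ring
      · rw [← h₂, ← hp (i + 2 * j + 1), hk]; congr 1; push_cast; ring
      · rw [← h₃, ← hp (i + 2 * j + 2), hk]; congr 1; push_cast; ring
    simp [this]

end ClosedWalks

/-! ### Assembling the zeta function. -/

section Zeta

open PowerSeries

variable {Γ Ω : Type*} [Fintype Ω] [DecidableEq Ω] {ΞΩ : Ω → Finset Ω}
  {ΞΓ : Γ → Finset Ω}

/-- `det (1 - N A z ^ 2)` as a power series, where `N` is the number of elements of `Γ`. -/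
noncomputable def altDet (Γ : Type*) {Ω : Type*} [Fintype Ω] [DecidableEq Ω]
    (ΞΩ : Ω → Finset Ω) : PowerSeries ℚ :=
  (1 - (PowerSeries.C (Nat.card Γ : ℚ) * PowerSeries.X ^ 2) •
    ((transitionMatrix ΞΩ).map (Int.cast : ℤ → ℚ)).map PowerSeries.C).det

lemma constantCoeff_altDet : constantCoeff (altDet Γ ΞΩ) = 1 := by
  rw [altDet, RingHom.map_det]
  have : (constantCoeff (R := ℚ)).mapMatrix (1 - (PowerSeries.C (Nat.card Γ : ℚ) *
      PowerSeries.X ^ 2) • ((transitionMatrix ΞΩ).map (Int.cast : ℤ → ℚ)).map PowerSeries.C) = 1 := by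
    ext i j
    by_cases h : i = j <;> simp [Matrix.one_apply, h]
  rw [this, Matrix.det_one]

/-- Because of the sign, the endless descents contribute the inverse of the determinant to the zeta
function. -/
lemma altDet_logDeriv [Finite Γ] : PowerSeries.X * derivative ℚ (altDet Γ ΞΩ) =
    -(PowerSeries.mk fun n => if n = 0 then 0 else ((altPoints Γ ΞΩ n).ncard : ℚ)) *
      altDet Γ ΞΩ := by
  rw [altDet, X_mul_derivative_det]
  congr 2
  ext n
  simp only [coeff_mk]
  split_ifs with h₀ h₁
  · rfl
  all_goals
    have h := congrArg (Int.cast : ℤ → ℚ) (ncard_altPoints (Γ := Γ) (ΞΩ := ΞΩ) h₀)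
    simp only [h₁, if_true, if_false] at h
    push_cast at h
    rw [h]
  have : (transitionMatrix ΞΩ).map (Int.cast : ℤ → ℚ) ^ (n / 2) =
      (transitionMatrix ΞΩ ^ (n / 2)).map (Int.cast : ℤ → ℚ) :=
    (map_pow (Int.castRingHom ℚ).mapMatrix (transitionMatrix ΞΩ) (n / 2)).symm
  rw [this]
  simp [Matrix.trace]

lemma periodicSeries_add [Finite Γ] : periodicSeries (xiShift ΞΩ ΞΓ) + circSeries (balanced ΞΩ ΞΓ) =
    (PowerSeries.mk fun n => if n = 0 then 0 else ((altPoints Γ ΞΩ n).ncard : ℚ)) +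
      circSeries (ascending ΞΩ ΞΓ) + circSeries (descending ΞΩ ΞΓ) := by
  ext n
  simp only [periodicSeries, circSeries, map_add, coeff_mk]
  split_ifs with h
  · simp
  · exact_mod_cast ncard_periodicPoints (ΞΩ := ΞΩ) (ΞΓ := ΞΓ) h

/-- Sums of logarithmic derivatives become products of series, so the inclusion-exclusion of
`periodicSeries_add` turns into this identity. It is stated without division. -/
lemma zeta_mul [Finite Γ] : zeta (xiShift ΞΩ ΞΓ) * (wordSeries (balanced ΞΩ ΞΓ) * altDet Γ ΞΩ) =
    wordSeries (ascending ΞΩ ΞΓ) * wordSeries (descending ΞΩ ΞΓ) := by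
  set a₀ := wordSeries (balanced ΞΩ ΞΓ)
  set a₁ := wordSeries (ascending ΞΩ ΞΓ)
  set a₂ := wordSeries (descending ΞΩ ΞΓ)
  set d := altDet Γ ΞΩ
  have h₀ : constantCoeff a₀ = 1 := constantCoeff_wordSeries veryPure_balanced.nil
  have h₁ : constantCoeff a₁ = 1 := constantCoeff_wordSeries veryPure_ascending.nil
  have h₂ : constantCoeff a₂ = 1 := constantCoeff_wordSeries veryPure_descending.nil
  have hd : constantCoeff d = 1 := constantCoeff_altDet
  have hc : constantCoeff (a₀ * d) ≠ 0 := by simp [h₀, hd]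
  set F := a₁ * a₂ * (a₀ * d)⁻¹ with hF
  have hF' : F * (a₀ * d) = a₁ * a₂ := by
    rw [hF, mul_assoc, PowerSeries.inv_mul_cancel _ hc, mul_one]
  have hz : zeta (xiShift ΞΩ ΞΓ) = F := by
    refine zeta_eq ?_ ?_
    · have := congrArg constantCoeff hF'
      simpa [h₀, h₁, h₂, hd] using this
    · have hne : a₀ * d ≠ 0 := fun h => hc (by simp [h])
      refine mul_right_cancel₀ hne ?_
      have h := congrArg (derivative ℚ) hF'
      simp only [Derivation.leibniz, smul_eq_mul] at h
      have e₀ : X * derivative ℚ a₀ = _ := circSeries_mul veryPure_balanced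
      have e₁ : X * derivative ℚ a₁ = _ := circSeries_mul veryPure_ascending
      have e₂ : X * derivative ℚ a₂ = _ := circSeries_mul veryPure_descending
      have ed : X * derivative ℚ d = _ := altDet_logDeriv
      have hp := periodicSeries_add (ΞΩ := ΞΩ) (ΞΓ := ΞΓ)
      linear_combination X * h + a₂ * e₁ + a₁ * e₂ - F * d * e₀ - F * a₀ * ed - F * a₀ * d * hp -
        (circSeries (ascending ΞΩ ΞΓ) + circSeries (descending ΞΩ ΞΓ)) * hF'
  rw [hz, hF']

lemma aeval_detOneSub : Polynomial.aeval ((Nat.card Γ : PowerSeries ℚ) * PowerSeries.X ^ 2)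
    (detOneSub (transitionMatrix ΞΩ)) = altDet Γ ΞΩ := by
  rw [detOneSub, altDet, AlgHom.map_det]
  congr 1
  ext1 i j
  by_cases h : i = j <;> simp [h]

end Zeta

end DyckLoop

/-! ### Elimination and the closed formula. -/

theorem theorem6p1 {Γ Ω : Type*} [Fintype Γ] [Fintype Ω] [DecidableEq Ω]
    (N J K L : ℕ) (hN : Fintype.card Γ = N) (hN1 : 1 < N) (hJ : Fintype.card Ω = J)
    (hK1 : 1 ≤ K) (hKJ : K ≤ J) (hL1 : 1 ≤ L) (hLJ : L ≤ J)
    (ΞΩ : Ω → Finset Ω) (hΞΩ : ∀ ω, (ΞΩ ω).card = K)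
    (ΞΓ : Γ → Finset Ω) (hΞΓ : ∀ γ, (ΞΓ γ).card = L)
    (hA : (DyckLoop.transitionMatrix ΞΩ).IsIrreducible)
    (p : ℕ) (hp : p = DyckLoop.matrixPeriod (DyckLoop.transitionMatrix ΞΩ))
    (z : PowerSeries ℚ) (hz : z = PowerSeries.X) :
    ∃ q : Polynomial ℤ,
      DyckLoop.detOneSub (DyckLoop.transitionMatrix ΞΩ) =
        q * (1 - (K : Polynomial ℤ) ^ p * Polynomial.X ^ p) ∧
    ∃ ρ : PowerSeries ℚ,
      PowerSeries.constantCoeff ρ = 1 ∧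
      ρ ^ 2 = (1 - J * z + N * ((L : PowerSeries ℚ) - K) * z ^ 3) ^ 2
        - 4 * N * L * z ^ 3 * (1 - J * z) ∧
    ∃ g : PowerSeries ℚ,
      g = PowerSeries.C (1 / 2 : ℚ) *
        (1 - J * z + N * ((L : PowerSeries ℚ) - K) * z ^ 3 - ρ) ∧
      DyckLoop.zeta (DyckLoop.xiShift ΞΩ ΞΓ) =
        (1 - J * z - g) *
          ((1 - ((J : PowerSeries ℚ) + N) * z - g) *
            ((1 - N * K * z ^ 2) * (1 - J * z) - g) *
            Polynomial.aeval (N * z ^ 2) q *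
            ∑ r ∈ Finset.range p, (N : PowerSeries ℚ) ^ r * (K : PowerSeries ℚ) ^ r *
              z ^ (2 * r))⁻¹ := by
  have hΩ : Nonempty Ω := Fintype.card_pos_iff.1 (by omega)
  have hNc : Nat.card Γ = N := by rw [Nat.card_eq_fintype_card, hN]
  have hJc : Nat.card Ω = J := by rw [Nat.card_eq_fintype_card, hJ]
  have hdvd := DyckLoop.one_sub_dvd_detOneSub hΞΩ hA
  rw [← hp] at hdvd
  obtain ⟨q, hq⟩ := hdvd
  rw [mul_comm] at hq
  have e₀ := DyckLoop.wordSeries_balanced (ΞΩ := ΞΩ) (ΞΓ := ΞΓ)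
  have e₁ := DyckLoop.wordSeries_ascending (ΞΩ := ΞΩ) (ΞΓ := ΞΓ)
  have e₂ := DyckLoop.wordSeries_descending (ΞΩ := ΞΩ) (ΞΓ := ΞΓ)
  have e₃ := DyckLoop.wordSeries_closing (ΞΓ := ΞΓ) hΞΩ
  have e₄ := DyckLoop.wordSeries_arches hΞΩ hΞΓ
  have hzeta := DyckLoop.zeta_mul (ΞΩ := ΞΩ) (ΞΓ := ΞΓ)
  have hdet := DyckLoop.aeval_detOneSub (Γ := Γ) (ΞΩ := ΞΩ)
  have hd := DyckLoop.constantCoeff_altDet (Γ := Γ) (ΞΩ := ΞΩ)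
  have h₀ := DyckLoop.constantCoeff_wordSeries (DyckLoop.veryPure_balanced (ΞΩ := ΞΩ) (ΞΓ := ΞΓ)).nil
  rw [hNc, hq] at hdet
  simp only [hNc, hJc] at e₀ e₁ e₂ e₃ e₄
  push_cast at e₀ e₁ e₂ e₃ e₄
  rw [← hz] at e₀ e₁ e₂ e₃ e₄ hdet
  generalize DyckLoop.wordSeries (DyckLoop.balanced ΞΩ ΞΓ) = a₀ at *
  generalize DyckLoop.wordSeries (DyckLoop.ascending ΞΩ ΞΓ) = a₁ at *
  generalize DyckLoop.wordSeries (DyckLoop.descending ΞΩ ΞΓ) = a₂ at *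
  generalize DyckLoop.wordSeries (DyckLoop.closing ΞΩ ΞΓ fun _ q => q = []) = f at *
  generalize DyckLoop.wordSeries (DyckLoop.arches ΞΩ ΞΓ) = g at *
  generalize DyckLoop.altDet Γ ΞΩ = d at *
  generalize DyckLoop.zeta (DyckLoop.xiShift ΞΩ ΞΓ) = ζ at *
  have hz₀ : PowerSeries.constantCoeff z = 0 := by simp [hz]
  have hg₀ : PowerSeries.constantCoeff g = 0 := by rw [e₄]; simp [hz₀]
  have k₀ : a₀ * (1 - J * z - g) = 1 := by linear_combination e₀
  have k₁ : a₁ * (1 - ((J : PowerSeries ℚ) + N) * z - g) = 1 := by linear_combination e₁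
  -- The series `f` of the closing words is eliminated by means of `f(1 - NKz²) = a₂g`.
  have k₂ : a₂ * ((1 - N * K * z ^ 2) * (1 - J * z) - g) = 1 - N * K * z ^ 2 := by
    linear_combination (1 - N * K * z ^ 2) * e₂ + e₃
  -- The arch equation multiplied by `1 - Jz - g`, the inverse of `a₀`.
  have kg : g ^ 2 - (1 - J * z + N * ((L : PowerSeries ℚ) - K) * z ^ 3) * g +
      N * L * z ^ 3 * (1 - J * z) = 0 := by
    linear_combination -(1 - J * z - g) * e₄ - g * (N * K * z ^ 3) * k₀
  -- The root is read off from `g` itself. Since `g` has constant term 0, its own constant term is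
  -- 1, which selects the branch.
  refine ⟨q, hq, 1 - J * z + N * ((L : PowerSeries ℚ) - K) * z ^ 3 - 2 * g, ?_, ?_, g, ?_, ?_⟩
  · simp [hz₀, hg₀]
  · linear_combination 4 * kg
  · have : PowerSeries.C (1 / 2 : ℚ) * 2 = 1 := by
      rw [← map_ofNat (PowerSeries.C (R := ℚ)) 2, ← map_mul]; simp
    linear_combination -g * this
  · set Q := Polynomial.aeval (N * z ^ 2) q
    set S := ∑ r ∈ Finset.range p, (N : PowerSeries ℚ) ^ r * (K : PowerSeries ℚ) ^ r * z ^ (2 * r)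
      with hS
    have hgeom : S * (1 - N * K * z ^ 2) = 1 - K ^ p * (N * z ^ 2) ^ p := by
      have := geom_sum_mul_neg ((N : PowerSeries ℚ) * K * z ^ 2) p
      rw [hS]
      simp only [mul_pow, ← pow_mul] at this ⊢
      rw [this]
      ring
    -- The factor `1 - K^p z^p` at `Nz²` is `1 - NKz²` times the geometric sum; this copy of `1 -
    -- NKz²` cancels against the one from `k₂`.
    have hdQ : Q * (S * (1 - N * K * z ^ 2)) = d := by
      rw [hgeom, ← hdet]
      simp [Q]
    have hQS : PowerSeries.constantCoeff Q * PowerSeries.constantCoeff S = 1 := by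
      rw [← hd, ← hdQ]; simp [hz₀]
    have hne : (1 - N * K * z ^ 2 : PowerSeries ℚ) ≠ 0 := by
      intro h
      have := congrArg PowerSeries.constantCoeff h
      simp [hz₀] at this
    have hne₀ : a₀ ≠ 0 := by
      rintro rfl
      simp at h₀
    rw [PowerSeries.eq_mul_inv_iff_mul_eq]
    · refine mul_right_cancel₀ hne₀ (mul_right_cancel₀ hne ?_)
      rw [← hdQ] at hzeta
      linear_combination (1 - ((J : PowerSeries ℚ) + N) * z - g) *
        ((1 - N * K * z ^ 2) * (1 - J * z) - g) * hzeta +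
        a₂ * ((1 - N * K * z ^ 2) * (1 - J * z) - g) * k₁ + k₂ - (1 - N * K * z ^ 2) * k₀
    · simp [hz₀, hg₀, mul_assoc, hQS]
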